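/- \textbf{Setting.} Let $\mathcal R$ be a finite set of linear existential rules $\rho=\forall\vec x\vec y\,(\Phi(\vec x,\vec y)\to\exists\vec z\,(\psi_1(\vec y,\vec z)\wedge\psi_2(\vec y,\vec z)))$, where $\Phi$ consists of at most one atom, the head consists of exactly two atoms $\psi_1,\psi_2$, $\vec x,\vec y$ are exactly the variables of $\Phi$, all terms of rules are variables, and predicates have fixed arities. Let $\omega$ be an atom over constants. Put $\mathbb A=\{\rho_\iota:\rho\in\mathcal R,\ \iota\in\{1,2\}\}$ and let $\omega\mathbb A^*$ be the set of all words (addresses) $\omega a_1\cdots a_n$ with $a_i\in\mathbb A$; the word $ua$ is the $a$-child of $u$. \textbf{Oblivious chase.} Define $F\subseteq\omega\mathbb A^*$ and a labelling $[\,\cdot\,]$ of $F$ by ground atoms inductively: $\omega\in F$ and $[\omega]=\omega$; if $u\in F$ and there is a homomorphism $h$ from the body of $\rho\in\mathcal R$ to $[u]$ (then $(\rho,u)$ is called a trigger), then $u\rho_1,u\rho_2\in F$, and $[u\rho_\iota]$ is obtained from $\psi_\iota$ by replacing each universally quantified variable $x$ with $h(x)$ and each existentially quantified variable $z$ with the labelled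 null $z^\rho_u$. \textbf{Derivations.} A trigger $\pi=(\rho,u)$ is active in $G\subseteq F$ if $u\in G$ and $\{u\rho_1,u\rho_2\}\not\subseteq G$. It is blocked in $G$ if there are $v_1,v_2\in G$ and a homomorphism (a map of terms) $h$ such that $h([u])=[u]$ and $h([u\rho_\iota])=[v_\iota]$ for $\iota=1,2$. An infinite derivation over $\{\omega\}$ is a sequence $\mathcal M=(\pi_n)_{n\in\mathbb N}$ of triggers such that, with $M_0=\{\omega\}$ and $M_{n+1}=M_n\cup\{u\rho_1,u\rho_2\}$ for $\pi_n=(\rho,u)$, each $\pi_n$ is active in $M_n$. It is oblivious if $\bigcup_n M_n=F$, and restricted if no $\pi_n$ is blocked in $M_n$. An \emph{$\omega$-sensitive-path-derivation} of $\mathcal R$ is a pair $(\mathcal M,\mathcal P)$, where $\mathcal M=(\pi_n)_n$ is an infinite oblivious derivation over $\{\omega\}$ and $\mathcal P$ is an infinite restricted derivation over $\{\omega\}$, such that (i) $\mathcal P$ is a subsequence of $\mathcal M$; (ii) whenever $\pi_n$ occurs in $\mathcal P$, it is not blocked in $M_n$; (iii) the set $\{u:(\rho,u)\text{ occurs in }\mathcal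 P\text{ for some }\rho\}$ is an infinite path, that is, of the form $\{w_0,w_1,\dots\}$ with $w_0=\omega$ and each $w_{n+1}$ a child of $w_n$. \textbf{Lemma (Third Main Lemma).} There is an algorithm (a computable function) which, given $\mathcal R$ and $\omega$ as above, outputs a sentence $\Omega_\omega$ (depending also on $\mathcal R$) of monadic second-order logic over the binary relation symbols $\mathrm{child}_a$, $a\in\mathbb A$, with equality, such that $$\omega\mathbb A^*\models\Omega_\omega\iff\text{there exists an }\omega\text{-sensitive-path-derivation of }\mathcal R ,$$ where $\omega\mathbb A^*$ is regarded as the structure whose elements are all addresses, in which $\mathrm{child}_a(u,v)$ holds iff $v=ua$, and in which set quantifiers range over all sets of addresses. -/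

import Mathlib

namespace Chase

/-! ### Atoms and linear rules

Predicates, variables and constants are named by natural numbers. -/

/-- An atom `P(t₁, …, tₖ)` over a set `T` of terms: a predicate and its list of terms. -/
abbrev Atom (T : Type) := ℕ × List T

/-- Apply a map of terms to an atom. -/
def Atom.map {S T : Type} (f : S → T) (α : Atom S) : Atom T := (α.1, α.2.map f)

/-- A linear existential rule with at most one body atom and exactly two head atoms. All terms in a
rule are variables. The variables of the body are the universally quantified ones, the variables
that occur only in the head are the existentially quantified ones. -/
abbrev Rule := Option (Atom ℕ) × Atom ℕ × Atom ℕ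

/-- The body of a rule (`none` is the empty conjunction). -/
def Rule.body (ρ : Rule) : Option (Atom ℕ) := ρ.1

/-- The two head atoms of a rule. -/
def Rule.head (ρ : Rule) (ι : Fin 2) : Atom ℕ := ![ρ.2.1, ρ.2.2] ι

/-- The universally quantified variables of a rule. -/
def Rule.bodyVars (ρ : Rule) : List ℕ := ρ.body.elim [] Prod.snd

/-- A finite set of rules, given by a list; order and repetitions play no role below. -/
abbrev RuleSet := List Rule

/-- All atoms of the rules in `R`, and the atom `ω`, obey the arities `ar`. -/
def RespectsArity (ar : ℕ → ℕ) (R : RuleSet) (ω : Atom ℕ) : Prop :=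
  (∀ ρ ∈ R, (∀ β ∈ ρ.body, β.2.length = ar β.1) ∧
    ∀ ι, (ρ.head ι).2.length = ar (ρ.head ι).1) ∧
  ω.2.length = ar ω.1

/-! ### Addresses and the representation of the oblivious chase over `{ω}` -/

/-- The address symbols `ρ_ι`, for `ρ` in `R` and `ι` one of the two indices. -/
abbrev Symb (R : RuleSet) := {ρ : Rule // ρ ∈ R} × Fin 2

/-- The addresses `ω a₁ … aₙ` over the one-atom instance `{ω}`. The leading `ω` is left out and the
word is stored from right to left, as `[aₙ, …, a₁]`: the root is `[]`, the `a`-child of `u` is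
`a :: u`. So this type is the whole set `ω𝔸*`. -/
abbrev Address (R : RuleSet) := List (Symb R)

/-- Ground terms: constants, and the labelled nulls `z_u^ρ`. -/
inductive Term (R : RuleSet) : Type
  | const (c : ℕ) : Term R
  | null (z : ℕ) (ρ : {ρ : Rule // ρ ∈ R}) (u : Address R) : Term R

/-- `h` is a homomorphism from the body of `ρ` to the atom `α`. -/
def IsBodyHom {R : RuleSet} (ρ : Rule) (h : ℕ → Term R) (α : Atom (Term R)) : Prop :=
  ∀ β ∈ ρ.body, Atom.map h β = α

/-- The `ι`-th atom produced by the rule `ρ` at the address `u` under the body homomorphism `h`: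
each existential variable `z` is replaced with the null `z_u^ρ`. -/
def ruleApply {R : RuleSet} (ρ : {ρ : Rule // ρ ∈ R}) (h : ℕ → Term R) (u : Address R)
    (ι : Fin 2) : Atom (Term R) :=
  Atom.map (fun x => if x ∈ ρ.1.bodyVars then h x else Term.null x ρ u) (ρ.1.head ι)

open Classical in
/-- The labelling of addresses by ground atoms; `none` means that the address is not in the forest
of the representation. (The body homomorphism is unique on the variables of the body, so its choice
does not matter.) -/
noncomputable def label (R : RuleSet) (ω : Atom ℕ) : Address R → Option (Atom (Term R))
  | [] => some (Atom.map Term.const ω)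
  | (ρ, ι) :: u =>
    (label R ω u).bind fun α =>
      if H : ∃ h : ℕ → Term R, IsBodyHom ρ.1 h α then some (ruleApply ρ H.choose u ι) else none

/-- The forest (here a tree) of the representation of the oblivious chase over `{ω}`. -/
def forest (R : RuleSet) (ω : Atom ℕ) : Set (Address R) := {u | label R ω u ≠ none}

/-! ### Triggers, blocking, derivations over `{ω}` -/

/-- A pair of a rule and an address; see `IsTrigger`. -/
abbrev Trigger (R : RuleSet) := {ρ : Rule // ρ ∈ R} × Address R

/-- `(ρ, u)` is a trigger: `u` is in the forest and the body of `ρ` maps to the atom at `u`. -/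
def IsTrigger (R : RuleSet) (ω : Atom ℕ) (π : Trigger R) : Prop :=
  ∃ α, label R ω π.2 = some α ∧ ∃ h : ℕ → Term R, IsBodyHom π.1.1 h α

/-- The two addresses created by a trigger. -/
def apply {R : RuleSet} (π : Trigger R) : Set (Address R) := {w | ∃ ι, w = (π.1, ι) :: π.2}

/-- The trigger `π` is active in `G`. -/
def IsActive {R : RuleSet} (π : Trigger R) (G : Set (Address R)) : Prop :=
  π.2 ∈ G ∧ ¬ apply π ⊆ G

/-- `[v 0, v 1]` is a blocking team for the trigger `π = (ρ, u)`: some map `h` of terms fixes the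
atom at `u` and sends the atom at `uρ_ι` to the atom at `v ι`, for both `ι`. -/
def IsBlockingTeam (R : RuleSet) (ω : Atom ℕ) (π : Trigger R) (v : Fin 2 → Address R) : Prop :=
  ∃ h : Term R → Term R,
    (label R ω π.2).map (Atom.map h) = label R ω π.2 ∧
    ∀ ι, (label R ω ((π.1, ι) :: π.2)).map (Atom.map h) = label R ω (v ι)

/-- The trigger `π` is blocked in `G`. -/
def IsBlocked (R : RuleSet) (ω : Atom ℕ) (π : Trigger R) (G : Set (Address R)) : Prop :=
  ∃ v : Fin 2 → Address R, (∀ ι, v ι ∈ G) ∧ IsBlockingTeam R ω π v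

/-- The `n`-th step of a sequence of triggers: the root and all that the first `n` triggers
created. -/
def step {R : RuleSet} (M : ℕ → Trigger R) : ℕ → Set (Address R)
  | 0 => {[]}
  | n + 1 => apply (M n) ∪ step M n

/-- An infinite chase derivation of `R` over `{ω}`. -/
def IsDerivation (R : RuleSet) (ω : Atom ℕ) (M : ℕ → Trigger R) : Prop :=
  ∀ n, IsTrigger R ω (M n) ∧ IsActive (M n) (step M n)

/-- The derivation creates the whole forest. -/
def IsOblivious (R : RuleSet) (ω : Atom ℕ) (M : ℕ → Trigger R) : Prop :=
  ⋃ n, step M n = forest R ω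

/-- No trigger of the derivation is blocked when it is applied. -/
def IsRestricted (R : RuleSet) (ω : Atom ℕ) (M : ℕ → Trigger R) : Prop :=
  ∀ n, ¬ IsBlocked R ω (M n) (step M n)

/-- The set `S` of addresses is an infinite path: it consists of addresses `w₀, w₁, …`, where `w₀`
is the root and each `wₙ₊₁` is a child of `wₙ`. -/
def IsInfinitePath {R : RuleSet} (S : Set (Address R)) : Prop :=
  ∃ w : ℕ → Address R, w 0 = [] ∧ (∀ n, ∃ a : Symb R, w (n + 1) = a :: w n) ∧ S = Set.range w

/-- `(M, P)` is an `ω`-sensitive-path-derivation of `R`. -/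
structure IsSensitivePathDerivation (R : RuleSet) (ω : Atom ℕ) (M P : ℕ → Trigger R) : Prop where
  derivation : IsDerivation R ω M
  oblivious : IsOblivious R ω M
  derivation' : IsDerivation R ω P
  restricted : IsRestricted R ω P
  subsequence : ∃ f : ℕ → ℕ, StrictMono f ∧ ∀ n, P n = M (f n)
  not_blocked : ∀ n, M n ∈ Set.range P → ¬ IsBlocked R ω (M n) (step M n)
  path : IsInfinitePath {u : Address R | ∃ ρ, (ρ, u) ∈ Set.range P}

/-! ### Monadic second-order logic with the binary relation symbols `child_{ρ_ι}` -/

/-- Formulas of monadic second-order logic. Node variables and set variables are two separate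
families of variables, each indexed by the natural numbers. -/
inductive MSO : Type
  | eq (x y : ℕ) : MSO
  | child (ρ : Rule) (ι : Fin 2) (x y : ℕ) : MSO
  | mem (x X : ℕ) : MSO
  | neg (φ : MSO) : MSO
  | and (φ ψ : MSO) : MSO
  | exNode (x : ℕ) (φ : MSO) : MSO
  | exSet (X : ℕ) (φ : MSO) : MSO

namespace MSO

/-- Free node variables. -/
def freeNode : MSO → Finset ℕ
  | eq x y => {x, y}
  | child _ _ x y => {x, y}
  | mem x _ => {x}
  | neg φ => φ.freeNode
  | and φ ψ => φ.freeNode ∪ ψ.freeNode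
  | exNode x φ => φ.freeNode.erase x
  | exSet _ φ => φ.freeNode

/-- Free set variables. -/
def freeSet : MSO → Finset ℕ
  | eq _ _ => ∅
  | child _ _ _ _ => ∅
  | mem _ X => {X}
  | neg φ => φ.freeSet
  | and φ ψ => φ.freeSet ∪ ψ.freeSet
  | exNode _ φ => φ.freeSet
  | exSet X φ => φ.freeSet.erase X

/-- A sentence is a formula without free variables. -/
def IsSentence (φ : MSO) : Prop := φ.freeNode = ∅ ∧ φ.freeSet = ∅

/-- Every relation symbol `child_{ρ_ι}` of the formula belongs to a rule `ρ` of `R`. -/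
def IsOver (R : RuleSet) : MSO → Prop
  | eq _ _ => True
  | child ρ _ _ _ => ρ ∈ R
  | mem _ _ => True
  | neg φ => φ.IsOver R
  | and φ ψ => φ.IsOver R ∧ ψ.IsOver R
  | exNode _ φ => φ.IsOver R
  | exSet _ φ => φ.IsOver R

/-- Satisfaction in a structure with carrier `D` and relations `rel ρ ι`, where `s` and `S` assign
values to the node variables and the set variables. Set quantifiers range over all subsets. -/
def Sat {D : Type} (rel : Rule → Fin 2 → D → D → Prop) : (ℕ → D) → (ℕ → Set D) → MSO → Prop
  | s, _, eq x y => s x = s y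
  | s, _, child ρ ι x y => rel ρ ι (s x) (s y)
  | s, S, mem x X => s x ∈ S X
  | s, S, neg φ => ¬ Sat rel s S φ
  | s, S, and φ ψ => Sat rel s S φ ∧ Sat rel s S ψ
  | s, S, exNode x φ => ∃ d : D, Sat rel (Function.update s x d) S φ
  | s, S, exSet X φ => ∃ A : Set D, Sat rel s (Function.update S X A) φ

/-- A bijective Gödel numbering of the formulas. -/
def toNat : MSO → ℕ
  | eq x y => 8 * Nat.pair x y
  | child ρ ι x y => 8 * Nat.pair (Encodable.encode ρ) (Nat.pair x y) + (1 + ι)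
  | mem x X => 8 * Nat.pair x X + 3
  | neg φ => 8 * φ.toNat + 4
  | and φ ψ => 8 * Nat.pair φ.toNat ψ.toNat + 5
  | exNode x φ => 8 * Nat.pair x φ.toNat + 6
  | exSet X φ => 8 * Nat.pair X φ.toNat + 7

/-- The inverse of `toNat`. -/
def ofNat (n : ℕ) : MSO :=
  if _h : n % 8 = 0 then eq (n / 8).unpair.1 (n / 8).unpair.2
  else if n % 8 = 1 then
    child (Denumerable.ofNat Rule (n / 8).unpair.1) 0
      (n / 8).unpair.2.unpair.1 (n / 8).unpair.2.unpair.2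
  else if n % 8 = 2 then
    child (Denumerable.ofNat Rule (n / 8).unpair.1) 1
      (n / 8).unpair.2.unpair.1 (n / 8).unpair.2.unpair.2
  else if n % 8 = 3 then mem (n / 8).unpair.1 (n / 8).unpair.2
  else if n % 8 = 4 then neg (ofNat (n / 8))
  else if n % 8 = 5 then and (ofNat (n / 8).unpair.1) (ofNat (n / 8).unpair.2)
  else if n % 8 = 6 then exNode (n / 8).unpair.1 (ofNat (n / 8).unpair.2)
  else exSet (n / 8).unpair.1 (ofNat (n / 8).unpair.2)
termination_by n
decreasing_by
  all_goals
    have h1 := Nat.unpair_left_le (n / 8)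
    have h2 := Nat.unpair_right_le (n / 8)
    omega

theorem ofNat_toNat (φ : MSO) : ofNat φ.toNat = φ := by
  have hm : ∀ a b : ℕ, (8 * a + b) % 8 = b % 8 := fun a b => by omega
  have hd : ∀ a b : ℕ, (8 * a + b) / 8 = a + b / 8 := fun a b => by omega
  induction φ with
  | eq x y => rw [toNat, ofNat]; simp
  | child ρ ι x y =>
    fin_cases ι <;>
    · rw [toNat, ofNat]
      simp only [hm, hd, Nat.unpair_pair, Denumerable.ofNat_encode, Nat.add_zero,
        Nat.reduceMod, Nat.reduceDiv, Fin.isValue, Fin.zero_eta,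
        Fin.mk_one, Nat.reduceAdd]
      simp
  | mem x X => rw [toNat, ofNat]; simp only [hm, hd]; simp
  | neg φ ih => rw [toNat, ofNat]; simp only [hm, hd]; simp [ih]
  | and φ ψ ih ih' => rw [toNat, ofNat]; simp only [hm, hd]; simp [ih, ih']
  | exNode x φ ih => rw [toNat, ofNat]; simp only [hm, hd]; simp [ih]
  | exSet X φ ih => rw [toNat, ofNat]; simp only [hm, hd]; simp [ih]

theorem toNat_ofNat (n : ℕ) : (ofNat n).toNat = n := by
  induction n using Nat.strong_induction_on with
  | _ n ih =>
    have h1 := Nat.unpair_left_le (n / 8)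
    have h2 := Nat.unpair_right_le (n / 8)
    rw [ofNat]
    split_ifs <;> simp only [toNat, Denumerable.encode_ofNat, Nat.pair_unpair]
    · omega
    · simp; omega
    · simp; omega
    · omega
    · rw [ih _ (by omega)]; omega
    · rw [ih _ (by omega), ih _ (by omega), Nat.pair_unpair]; omega
    · rw [ih _ (by omega), Nat.pair_unpair]; omega
    · rw [ih _ (by omega), Nat.pair_unpair]; omega

/-- The Gödel numbering as a bijection. -/
def equivNat : MSO ≃ ℕ := ⟨toNat, ofNat, ofNat_toNat, toNat_ofNat⟩

/-- Computability of functions with values in formulas refers to the Gödel numbering `toNat`. -/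
instance : Primcodable MSO := Primcodable.ofEquiv ℕ equivNat

end MSO

/-- The relation `child_{ρ_ι}` on `ω𝔸*`: the second address is the `ρ_ι`-child of the first. -/
def treeChild (R : RuleSet) (ρ : Rule) (ι : Fin 2) (u v : Address R) : Prop :=
  ∃ hρ : ρ ∈ R, v = (⟨ρ, hρ⟩, ι) :: u

/-- The sentence `φ` is true in the tree `ω𝔸*` with the relations `child_{ρ_ι}`. -/
def TreeModels (R : RuleSet) (φ : MSO) : Prop :=
  ∀ (s : ℕ → Address R) (S : ℕ → Set (Address R)), MSO.Sat (treeChild R) s S φ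

end Chase

/-! The proof has two halves: sensitive-path-derivations are characterised by a single set of
addresses, and that characterisation is written in monadic second-order logic.

Combinatorics. A derivation is a timing of triggers, over which MSO cannot quantify, but little of
the timing matters. Fix an infinite path `A` in the forest. When the trigger of `A` at `u` is
applied, the outputs of the path triggers above `u` are present, because `u` is. Every address
created by a trigger off the path can be postponed by any finite amount, though not forever, since
the derivation is oblivious. A team has two members, so the right condition (`IsUnblockedPath`) is:
for all `v`, `v'` there is a node `p` of `A` such that no trigger of `A` is blocked by a team of
forced addresses, and from `p` on none is blocked by a team of forced addresses together with `v`,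
`v'`. Necessity (`IsSensitivePathDerivation.exists_isUnblockedPath`): a trigger at depth `n` cannot
be applied before step `n`, so beyond some depth `v` and `v'`, if in the forest, are already
present. Sufficiency (`IsUnblockedPath.exists_isSensitivePathDerivation`): only finitely many
addresses come from triggers of code at most `m`, so the depth of `p` is bounded uniformly on pairs
of them. Off-path triggers are delayed according to this bound; by the time such addresses exist,
the path has passed the relevant `p`.

Logic. `exists_bodyHom_iff` and `isBlockingTeam_iff` reduce matching and blocking to predicates,
arities and equalities of terms at boundedly many positions. There are infinitely many terms, but
two positions carry the same term iff copying connects them, that is, iff every family of sets (one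
per position) closed under copying that contains the first contains the second
(`IsClosedFamily.mem_iff`, `sat_termEqF`). The rest needs only children and descendants.

The sentence arises from `R` and `ω` by primitive recursive operations, hence computably. -/

namespace Chase

/-! ### Tracing the terms of the labels -/

section Labels

variable {R : RuleSet} {ω : Atom ℕ}

/-- The predicate and the number of terms of the atom at an address. -/
def shape (ω : Atom ℕ) : Address R → ℕ × ℕ
  | [] => (ω.1, ω.2.length)
  | (ρ, ι) :: _ => ((ρ.1.head ι).1, (ρ.1.head ι).2.length)

/-- The term at position `i` of the atom at an address, computed without checking that the bodies
of the rules match. -/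
def termAt (ω : Atom ℕ) : Address R → ℕ → Option (Term R)
  | [], i => ω.2[i]?.map Term.const
  | (ρ, ι) :: u, i => (ρ.1.head ι).2[i]?.bind fun x =>
      if x ∈ ρ.1.bodyVars then termAt ω u (ρ.1.bodyVars.idxOf x) else some (Term.null x ρ u)

/-- The body of `ρ` matches the atom at `u`, expressed through `shape` and `termAt`. -/
def BodyMatch (ω : Atom ℕ) (ρ : Rule) (u : Address R) : Prop :=
  (∀ β ∈ ρ.body, shape ω u = (β.1, β.2.length)) ∧
    ∀ i j, ρ.bodyVars[i]? ≠ none → ρ.bodyVars[i]? = ρ.bodyVars[j]? → termAt ω u i = termAt ω u j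

theorem label_cons_eq_some {ρ : {ρ : Rule // ρ ∈ R}} {ι : Fin 2} {u : Address R}
    {α : Atom (Term R)} (h : label R ω ((ρ, ι) :: u) = some α) :
    ∃ α' g, label R ω u = some α' ∧ IsBodyHom ρ.1 g α' ∧ α = ruleApply ρ g u ι := by
  rw [label, Option.bind_eq_some_iff] at h
  obtain ⟨α', h1, h2⟩ := h
  split_ifs at h2 with H
  exact ⟨α', H.choose, h1, H.choose_spec, by simpa using h2.symm⟩

theorem IsBodyHom.apply_eq {ρ : Rule} {g : ℕ → Term R} {α : Atom (Term R)}
    (hg : IsBodyHom ρ g α) {x : ℕ} (hx : x ∈ ρ.bodyVars) :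
    α.2[ρ.bodyVars.idxOf x]? = some (g x) := by
  unfold Rule.bodyVars at hx ⊢
  cases hb : ρ.body with
  | none => simp [hb] at hx
  | some β =>
    have hα := hg β (by simp [hb])
    subst hα
    simp only [hb, Option.elim_some] at hx ⊢
    simp [Atom.map, List.getElem?_eq_getElem (List.idxOf_lt_length_of_mem hx)]

/-- On the forest the unchecked tracing agrees with the chase. This separates where a term comes
from, which is pure bookkeeping of positions, from whether the bodies match. -/
theorem label_eq_some {u : Address R} : ∀ {α : Atom (Term R)}, label R ω u = some α →
    shape ω u = (α.1, α.2.length) ∧ ∀ i, α.2[i]? = termAt ω u i := by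
  induction u with
  | nil =>
    intro α h
    simp only [label, Option.some.injEq] at h
    subst h
    simp [shape, termAt, Atom.map]
  | cons a u ih =>
    obtain ⟨ρ, ι⟩ := a
    intro α h
    obtain ⟨α', g, h1, hg, rfl⟩ := label_cons_eq_some h
    refine ⟨by simp [shape, ruleApply, Atom.map], fun i => ?_⟩
    simp only [ruleApply, Atom.map, termAt, List.getElem?_map]
    cases (ρ.1.head ι).2[i]? with
    | none => rfl
    | some x =>
      simp only [Option.map_some, Option.bind_some]
      split_ifs with hx
      · rw [← (ih h1).2, hg.apply_eq hx]
      · rfl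

theorem atom_eq {T : Type} {α β : Atom T} (h1 : α.1 = β.1) (h2 : ∀ i : ℕ, α.2[i]? = β.2[i]?) :
    α = β :=
  Prod.ext h1 (List.ext_getElem? h2)

/-- A homomorphism is read off from the first occurrence of each body variable; the only obstruction
is a repeated variable that meets two different terms. -/
theorem exists_bodyHom_iff {ρ : Rule} {u : Address R} {α : Atom (Term R)}
    (hα : label R ω u = some α) : (∃ g : ℕ → Term R, IsBodyHom ρ g α) ↔ BodyMatch ω ρ u := by
  obtain ⟨hs, ht⟩ := label_eq_some hα
  constructor
  · rintro ⟨g, hg⟩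
    refine ⟨fun β hβ => ?_, fun i j hi hij => ?_⟩
    · rw [hs, ← hg β hβ]
      simp [Atom.map]
    · rw [← ht, ← ht]
      unfold Rule.bodyVars at hi hij
      cases hb : ρ.body with
      | none => simp [hb] at hi
      | some β =>
        rw [← hg β (by simp [hb])]
        simp only [hb, Option.elim_some] at hij
        simp [Atom.map, hij]
  · rintro ⟨h1, h2⟩
    -- The default value is immaterial: only the values on body variables count.
    refine ⟨fun x => (α.2[ρ.bodyVars.idxOf x]?).getD (Term.const 0), fun β hβ => ?_⟩
    have hb : ρ.bodyVars = β.2 := by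
      rw [Option.mem_def] at hβ
      simp [Rule.bodyVars, hβ]
    have hsh := h1 β hβ
    rw [hs, Prod.mk.injEq] at hsh
    refine atom_eq hsh.1.symm fun i => ?_
    simp only [Atom.map, List.getElem?_map, hb]
    by_cases hi : i < β.2.length
    · have hm : β.2[i] ∈ β.2 := List.getElem_mem hi
      have := h2 i (β.2.idxOf β.2[i]) (by simp [hb, hi])
        (by simp [hb, hi, List.getElem?_eq_getElem (List.idxOf_lt_length_of_mem hm)])
      rw [List.getElem?_eq_getElem hi, Option.map_some, ht, ← this, ← ht,
        List.getElem?_eq_getElem (by omega)]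
      simp
    · rw [List.getElem?_eq_none (by omega), List.getElem?_eq_none (by omega)]
      rfl

theorem label_cons_ne_none_iff {ρ : {ρ : Rule // ρ ∈ R}} {ι : Fin 2} {u : Address R} :
    label R ω ((ρ, ι) :: u) ≠ none ↔ label R ω u ≠ none ∧ BodyMatch ω ρ.1 u := by
  cases hu : label R ω u with
  | none => simp [label, hu]
  | some α =>
    rw [← exists_bodyHom_iff hu]
    simp [label, hu]

theorem isTrigger_iff {ρ : {ρ : Rule // ρ ∈ R}} {u : Address R} (ι : Fin 2) :
    IsTrigger R ω (ρ, u) ↔ label R ω ((ρ, ι) :: u) ≠ none := by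
  rw [label_cons_ne_none_iff]
  constructor
  · rintro ⟨α, hα, h⟩
    exact ⟨by simp_all, (exists_bodyHom_iff hα).1 h⟩
  · rintro ⟨h1, h2⟩
    obtain ⟨α, hα⟩ := Option.ne_none_iff_exists'.1 h1
    exact ⟨α, hα, (exists_bodyHom_iff hα).2 h2⟩

/-- Nulls enter one level below the address that indexes them and are then only copied downwards. In
particular, the nulls created by a trigger at `u` do not occur in the atom at `u`. -/
theorem length_lt_of_termAt_eq_null {u : Address R} {z : ℕ} {ρ : {ρ : Rule // ρ ∈ R}}
    {w : Address R} : ∀ {i : ℕ}, termAt ω u i = some (Term.null z ρ w) → w.length < u.length := by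
  induction u with
  | nil => simp [termAt]
  | cons a u ih =>
    intro i h
    rw [termAt, Option.bind_eq_some_iff] at h
    obtain ⟨x, -, h⟩ := h
    split_ifs at h with hx
    · have := ih h
      simp only [List.length_cons]
      omega
    · simp only [Option.some.injEq, Term.null.injEq] at h
      simp [h.2.2]

theorem termAt_cons {ρ : {ρ : Rule // ρ ∈ R}} {ι : Fin 2} {u : Address R} {k x : ℕ}
    (h : (ρ.1.head ι).2[k]? = some x) : termAt ω ((ρ, ι) :: u) k =
      if x ∈ ρ.1.bodyVars then termAt ω u (ρ.1.bodyVars.idxOf x) else some (Term.null x ρ u) := by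
  simp [termAt, h]

/-- A blocking map must fix the terms of the atom at `u` and is free on the new nulls, which are
fresh for that atom. So it exists as soon as copied terms reappear unchanged in the team and all
occurrences of a variable, across both head atoms, meet the same term. -/
theorem isBlockingTeam_iff {ρ : {ρ : Rule // ρ ∈ R}} {u : Address R}
    (h : IsTrigger R ω (ρ, u)) (v : Fin 2 → Address R) :
    IsBlockingTeam R ω (ρ, u) v ↔
      (∀ ι, label R ω (v ι) ≠ none ∧
        shape ω (v ι) = ((ρ.1.head ι).1, (ρ.1.head ι).2.length)) ∧
      (∀ ι k x, (ρ.1.head ι).2[k]? = some x → x ∈ ρ.1.bodyVars →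
        termAt ω u (ρ.1.bodyVars.idxOf x) = termAt ω (v ι) k) ∧
      ∀ ι κ k l, (ρ.1.head ι).2[k]? ≠ none → (ρ.1.head ι).2[k]? = (ρ.1.head κ).2[l]? →
        termAt ω (v ι) k = termAt ω (v κ) l := by
  classical
  obtain ⟨α, hα, hb⟩ := id h
  have hα' := (label_eq_some hα).2
  have hl : ∀ ι, ∃ β, label R ω ((ρ, ι) :: u) = some β := fun ι =>
    Option.ne_none_iff_exists'.1 ((isTrigger_iff ι).1 h)
  choose β hβ using hl
  have hβs := fun ι => (label_eq_some (hβ ι)).1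
  have hβt := fun ι => (label_eq_some (hβ ι)).2
  constructor
  · rintro ⟨g, hg, hv⟩
    simp only [hα, Option.map_some, Option.some.injEq] at hg
    have hfix : ∀ i, (termAt ω u i).map g = termAt ω u i := fun i => by
      rw [← hα']
      conv_rhs => rw [← hg]
      simp [Atom.map]
    have hvs : ∀ ι, label R ω (v ι) = some (Atom.map g (β ι)) := fun ι => by
      rw [← hv ι, hβ ι]
      rfl
    have hvt : ∀ ι k, termAt ω (v ι) k = (termAt ω ((ρ, ι) :: u) k).map g := fun ι k => by
      rw [← (label_eq_some (hvs ι)).2, ← hβt]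
      simp [Atom.map]
    refine ⟨fun ι => ⟨by simp [hvs], ?_⟩, fun ι k x hx hxb => ?_, fun ι κ k l hk hkl => ?_⟩
    · rw [(label_eq_some (hvs ι)).1]
      have := hβs ι
      simp only [shape] at this
      rw [this]
      simp [Atom.map]
    · rw [hvt, termAt_cons hx, if_pos hxb, hfix]
    · obtain ⟨x, hx⟩ := Option.ne_none_iff_exists'.1 hk
      rw [hvt, hvt, termAt_cons hx, termAt_cons (hkl ▸ hx)]
  · rintro ⟨h1, h2, h3⟩
    have hmem : ∀ {i t}, termAt ω u i = some t → t ∈ α.2 := fun {i t} hi =>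
      List.mem_of_getElem? ((hα' i).trans hi)
    have key : ∀ {ι k t}, termAt ω ((ρ, ι) :: u) k = some t → ∃ x, (ρ.1.head ι).2[k]? = some x ∧
        ((t ∈ α.2 ∧ x ∈ ρ.1.bodyVars ∧ termAt ω u (ρ.1.bodyVars.idxOf x) = some t) ∨
          (t ∉ α.2 ∧ t = Term.null x ρ u)) := by
      intro ι k t ht
      cases hx : (ρ.1.head ι).2[k]? with
      | none => simp [termAt, hx] at ht
      | some x =>
        rw [termAt_cons hx] at ht
        refine ⟨x, rfl, ?_⟩
        split_ifs at ht with hxb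
        · exact .inl ⟨hmem ht, hxb, ht⟩
        · simp only [Option.some.injEq] at ht
          -- A new null inside the atom at `u` would make `u` strictly shorter than itself.
          refine .inr ⟨fun hm => ?_, ht.symm⟩
          obtain ⟨i, hi⟩ := List.mem_iff_getElem?.1 hm
          rw [hα', ← ht] at hi
          exact lt_irrefl _ (length_lt_of_termAt_eq_null hi)
    -- Identity on the atom at `u`; a new null goes to the team's term at a chosen occurrence, the
    -- choice being immaterial by `h3`; elsewhere the value is irrelevant.
    let g : Term R → Term R := fun t => if t ∈ α.2 then t else
      if H : ∃ q : Fin 2 × ℕ, termAt ω ((ρ, q.1) :: u) q.2 = some t then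
        (termAt ω (v H.choose.1) H.choose.2).getD t else t
    refine ⟨g, ?_, fun ι => ?_⟩
    · rw [hα, Option.map_some]
      congr 1
      refine Prod.ext rfl ?_
      simp only [Atom.map]
      conv_rhs => rw [← List.map_id α.2]
      exact List.map_congr_left fun t ht => by simp [g, ht]
    · obtain ⟨γ, hγ⟩ := Option.ne_none_iff_exists'.1 (h1 ι).1
      obtain ⟨hγs, hγt⟩ := label_eq_some hγ
      have hs : (γ.1, γ.2.length) = ((β ι).1, (β ι).2.length) := by
        rw [← hγs, ← hβs, (h1 ι).2]
        rfl
      rw [Prod.mk.injEq] at hs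
      rw [hβ, hγ, Option.map_some]
      congr 1
      refine atom_eq hs.1.symm fun k => ?_
      simp only [Atom.map, List.getElem?_map]
      by_cases hk : k < (β ι).2.length
      · obtain ⟨t, ht⟩ : ∃ t, (β ι).2[k]? = some t := ⟨_, List.getElem?_eq_getElem hk⟩
        obtain ⟨s, hs⟩ : ∃ s, γ.2[k]? = some s := ⟨_, List.getElem?_eq_getElem (hs.2 ▸ hk)⟩
        rw [ht, hs, Option.map_some, Option.some.injEq]
        rw [hβt] at ht
        rw [hγt] at hs
        obtain ⟨x, hx, ⟨htm, hxb, hx'⟩ | ⟨htm, hx'⟩⟩ := key ht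
        · have := h2 ι k x hx hxb
          rw [hx', hs, Option.some.injEq] at this
          simpa only [g, if_pos htm] using this
        · have H : ∃ q : Fin 2 × ℕ, termAt ω ((ρ, q.1) :: u) q.2 = some t := ⟨(ι, k), ht⟩
          obtain ⟨y, hy, ⟨h', -⟩ | ⟨-, hy'⟩⟩ := key H.choose_spec
          · exact absurd h' htm
          · rw [hx'] at hy'
            simp only [Term.null.injEq, and_true] at hy'
            have := h3 ι H.choose.1 k H.choose.2 (by simp [hx]) (by rw [hx, hy, hy'])
            simp only [g, if_neg htm, dif_pos H, ← this, hs, Option.getD_some]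
      · rw [List.getElem?_eq_none (by omega), List.getElem?_eq_none (by omega)]
        rfl

end Labels

/-! ### Formulas of monadic second-order logic -/

namespace MSO

/-- A valid formula. -/
def tt : MSO := exNode 0 (eq 0 0)

/-- The formula that is valid if `b` is true and unsatisfiable otherwise. -/
def const (b : Bool) : MSO := bif b then tt else neg tt

/-- Disjunction. -/
def or (φ ψ : MSO) : MSO := neg (and (neg φ) (neg ψ))

/-- Implication. -/
def imp (φ ψ : MSO) : MSO := neg (and φ (neg ψ))

/-- Equivalence. -/
def iff (φ ψ : MSO) : MSO := and (imp φ ψ) (imp ψ φ)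

/-- Universal quantification over nodes. -/
def allNode (x : ℕ) (φ : MSO) : MSO := neg (exNode x (neg φ))

/-- Universal quantification over sets. -/
def allSet (X : ℕ) (φ : MSO) : MSO := neg (exSet X (neg φ))

/-- The conjunction of the formulas `f b` for `b` in the list `l`. -/
def conj {β : Type} (l : List β) (f : β → MSO) : MSO := l.foldr (fun b φ => and (f b) φ) tt

/-- The disjunction of the formulas `f b` for `b` in the list `l`. -/
def disj {β : Type} (l : List β) (f : β → MSO) : MSO := neg (conj l fun b => neg (f b))

/-- Existential quantification over the set variables `2, …, K + 1`. -/
def exSets (K : ℕ) (φ : MSO) : MSO := K.rec φ fun k ψ => exSet (k + 2) ψ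

/-- Existential quantification over the first `n` node variables and set variables. -/
def exFirst (n : ℕ) (φ : MSO) : MSO := n.rec φ fun k ψ => exNode k (exSet k ψ)

/-- A sentence obtained by quantifying all variables of a formula. -/
def close (φ : MSO) : MSO := exFirst (φ.toNat + 1) φ

/-! ### Truth of the derived connectives and quantifiers -/

section Sat

variable {D : Type} {rel : Rule → Fin 2 → D → D → Prop} {s : ℕ → D} {S : ℕ → Set D}

@[simp] theorem sat_eq {x y : ℕ} : Sat rel s S (eq x y) ↔ s x = s y := Iff.rfl

@[simp] theorem sat_child {ρ : Rule} {ι : Fin 2} {x y : ℕ} :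
    Sat rel s S (child ρ ι x y) ↔ rel ρ ι (s x) (s y) := Iff.rfl

@[simp] theorem sat_mem {x X : ℕ} : Sat rel s S (mem x X) ↔ s x ∈ S X := Iff.rfl

@[simp] theorem sat_neg {φ : MSO} : Sat rel s S (neg φ) ↔ ¬ Sat rel s S φ := Iff.rfl

@[simp] theorem sat_and {φ ψ : MSO} :
    Sat rel s S (and φ ψ) ↔ Sat rel s S φ ∧ Sat rel s S ψ := Iff.rfl

@[simp] theorem sat_exNode {x : ℕ} {φ : MSO} :
    Sat rel s S (exNode x φ) ↔ ∃ d, Sat rel (Function.update s x d) S φ := Iff.rfl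

@[simp] theorem sat_exSet {X : ℕ} {φ : MSO} :
    Sat rel s S (exSet X φ) ↔ ∃ A, Sat rel s (Function.update S X A) φ := Iff.rfl

@[simp] theorem sat_tt : Sat rel s S tt := ⟨s 0, rfl⟩

@[simp] theorem sat_const {b : Bool} : Sat rel s S (const b) ↔ b = true := by
  cases b <;> simp [const]

@[simp] theorem sat_or {φ ψ : MSO} :
    Sat rel s S (or φ ψ) ↔ Sat rel s S φ ∨ Sat rel s S ψ := by
  simp only [or, sat_neg, sat_and]; tauto

@[simp] theorem sat_imp {φ ψ : MSO} :
    Sat rel s S (imp φ ψ) ↔ (Sat rel s S φ → Sat rel s S ψ) := by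
  simp only [imp, sat_neg, sat_and]; tauto

@[simp] theorem sat_iff {φ ψ : MSO} :
    Sat rel s S (iff φ ψ) ↔ (Sat rel s S φ ↔ Sat rel s S ψ) := by
  simp only [iff, sat_imp, sat_and]; tauto

@[simp] theorem sat_allNode {x : ℕ} {φ : MSO} :
    Sat rel s S (allNode x φ) ↔ ∀ d, Sat rel (Function.update s x d) S φ := by
  simp [allNode]

@[simp] theorem sat_allSet {X : ℕ} {φ : MSO} :
    Sat rel s S (allSet X φ) ↔ ∀ A, Sat rel s (Function.update S X A) φ := by
  simp [allSet]

@[simp] theorem sat_conj {β : Type} {l : List β} {f : β → MSO} :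
    Sat rel s S (conj l f) ↔ ∀ b ∈ l, Sat rel s S (f b) := by
  induction l with
  | nil => simp [conj]
  | cons b l ih =>
    rw [List.forall_mem_cons, ← ih]
    rfl

@[simp] theorem sat_disj {β : Type} {l : List β} {f : β → MSO} :
    Sat rel s S (disj l f) ↔ ∃ b ∈ l, Sat rel s S (f b) := by
  simp [disj]

theorem sat_exSets {K : ℕ} {φ : MSO} : Sat rel s S (exSets K φ) ↔
    ∃ A : ℕ → Set D, Sat rel s (fun n => if n ∈ Set.Ico 2 (K + 2) then A (n - 2) else S n) φ := by
  induction K generalizing S with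
  | zero =>
    have : ∀ A : ℕ → Set D, (fun n => if n ∈ Set.Ico 2 (0 + 2) then A (n - 2) else S n) = S :=
      fun A => by funext n; simp
    simp only [this, exists_const]
    rfl
  | succ K ih =>
    change (∃ A, Sat rel s (Function.update S (K + 2) A) (exSets K φ)) ↔ _
    simp only [ih]
    constructor
    · rintro ⟨B, A, h⟩
      refine ⟨Function.update A K B, ?_⟩
      convert h using 1
      funext n
      simp only [Set.mem_Ico, Function.update_apply]
      split_ifs <;> first | rfl | omega
    · rintro ⟨A, h⟩
      refine ⟨A K, A, ?_⟩
      convert h using 1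
      funext n
      simp only [Set.mem_Ico, Function.update_apply]
      split_ifs with h1 h2 h3 h4 <;> first | rfl | omega | (subst h3; rfl)

/-- If the truth of a formula does not depend on the assignment, superfluous quantifiers over a
nonempty carrier are harmless. Hence a sentence can be obtained by crude syntactic closure. -/
theorem sat_exFirst [Nonempty D] {φ : MSO} {p : Prop} (h : ∀ s S, Sat rel s S φ ↔ p) (n : ℕ) :
    ∀ s S, Sat rel s S (exFirst n φ) ↔ p := by
  induction n with
  | zero => exact h
  | succ n ih =>
    intro s S
    change (∃ d, ∃ A, Sat rel _ _ (exFirst n φ)) ↔ p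
    simp [ih]

theorem sat_close [Nonempty D] {φ : MSO} {p : Prop} (h : ∀ s S, Sat rel s S φ ↔ p) :
    ∀ s S, Sat rel s S (close φ) ↔ p :=
  sat_exFirst h _

end Sat

/-! ### Restriction to the relation symbols of `R` -/

section IsOver

variable {R : RuleSet} {φ ψ : MSO}

theorem isOver_const (b : Bool) : (const b).IsOver R := by
  cases b <;> exact trivial

theorem IsOver.conj {β : Type} {l : List β} {f : β → MSO} (h : ∀ b ∈ l, (f b).IsOver R) :
    (conj l f).IsOver R := by
  induction l with
  | nil => exact trivial
  | cons b l ih =>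
    rw [List.forall_mem_cons] at h
    exact ⟨h.1, ih h.2⟩

theorem IsOver.exSets (K : ℕ) (h : φ.IsOver R) : (exSets K φ).IsOver R := by
  induction K with
  | zero => exact h
  | succ K ih => exact ih

theorem IsOver.exFirst (n : ℕ) (h : φ.IsOver R) : (exFirst n φ).IsOver R := by
  induction n with
  | zero => exact h
  | succ K ih => exact ih

theorem IsOver.close (h : φ.IsOver R) : (close φ).IsOver R := h.exFirst _

end IsOver

/-- Pairing dominates both components, so the Gödel number bounds every variable index. This is why
`close` can bind everything without computing the free variables. -/
theorem vars_subset (φ : MSO) : φ.freeNode ⊆ Finset.range (φ.toNat + 1) ∧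
    φ.freeSet ⊆ Finset.range (φ.toNat + 1) := by
  have hl := Nat.left_le_pair
  have hr := Nat.right_le_pair
  induction φ with
  | eq x y =>
    have := hl x y
    have := hr x y
    simp only [freeNode, freeSet, toNat, Finset.subset_iff, Finset.mem_insert,
      Finset.mem_singleton, Finset.mem_range, Finset.notMem_empty]
    grind
  | child ρ ι x y =>
    have := hl x y
    have := hr x y
    have := hr (Encodable.encode ρ) (Nat.pair x y)
    simp only [freeNode, freeSet, toNat, Finset.subset_iff, Finset.mem_insert,
      Finset.mem_singleton, Finset.mem_range, Finset.notMem_empty]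
    grind
  | mem x X =>
    have := hl x X
    have := hr x X
    simp only [freeNode, freeSet, toNat, Finset.subset_iff, Finset.mem_singleton, Finset.mem_range]
    grind
  | neg φ ih =>
    simp only [freeNode, freeSet, toNat, Finset.subset_iff, Finset.mem_range] at ih ⊢
    grind
  | and φ ψ ih ih' =>
    have := hl φ.toNat ψ.toNat
    have := hr φ.toNat ψ.toNat
    simp only [freeNode, freeSet, toNat, Finset.subset_iff, Finset.mem_union,
      Finset.mem_range] at ih ih' ⊢
    grind
  | exNode x φ ih =>
    have := hr x φ.toNat
    simp only [freeNode, freeSet, toNat, Finset.subset_iff, Finset.mem_erase,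
      Finset.mem_range] at ih ⊢
    grind
  | exSet X φ ih =>
    have := hr X φ.toNat
    simp only [freeNode, freeSet, toNat, Finset.subset_iff, Finset.mem_erase,
      Finset.mem_range] at ih ⊢
    grind

theorem free_exFirst (n : ℕ) (φ : MSO) :
    (exFirst n φ).freeNode = φ.freeNode \ Finset.range n ∧
      (exFirst n φ).freeSet = φ.freeSet \ Finset.range n := by
  induction n with
  | zero => simp [exFirst]
  | succ n ih =>
    change (exFirst n φ).freeNode.erase n = _ ∧ (exFirst n φ).freeSet.erase n = _
    rw [ih.1, ih.2]
    constructor <;> ext m <;> simp only [Finset.mem_erase, Finset.mem_sdiff, Finset.mem_range] <;>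
      grind

theorem isSentence_close (φ : MSO) : (close φ).IsSentence := by
  obtain ⟨h1, h2⟩ := vars_subset φ
  obtain ⟨h3, h4⟩ := free_exFirst (φ.toNat + 1) φ
  exact ⟨h3.trans (Finset.sdiff_eq_empty_iff_subset.2 h1),
    h4.trans (Finset.sdiff_eq_empty_iff_subset.2 h2)⟩

attribute [irreducible] close

end MSO

/-! ### The sentence

The set variable `0` stands for the path, the set variables `2, 3, …` for the families of sets used
in `termEqF`. -/

/-- The pairs of a rule and a head index. -/
def symbols (R : RuleSet) : List (Rule × Fin 2) := R.flatMap fun ρ => [(ρ, 0), (ρ, 1)]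

/-- A bound on the numbers of terms of the atoms in `R` and `ω`. -/
def maxPos (c : RuleSet × Atom ℕ) : ℕ :=
  c.1.foldr (fun ρ n => ρ.bodyVars.length + (ρ.head 0).2.length + (ρ.head 1).2.length + n)
    c.2.2.length

/-- The variables of a head atom. -/
def headVars (a : Rule × Fin 2) : List ℕ := (a.1.head a.2).2

/-- The predicate and the number of terms of a head atom. -/
def headShape (a : Rule × Fin 2) : ℕ × ℕ := ((a.1.head a.2).1, (headVars a).length)

/-- The predicate and the number of terms of the body. -/
def bodyShape (ρ : Rule) : ℕ × ℕ := ρ.body.elim (0, 0) fun β => (β.1, β.2.length)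

/-- The `i`-th entry of `l` exists and is equal to the `j`-th entry of `l'`. -/
def sameVar (l : List ℕ) (i : ℕ) (l' : List ℕ) (j : ℕ) : Bool :=
  decide (l[i]? ≠ none ∧ l[i]? = l'[j]?)

/-- The `i`-th variable of the head atom `a` is universally quantified and has its first occurrence
in the body at position `j`. -/
def isCopy (a : Rule × Fin 2) (i j : ℕ) : Bool :=
  decide ((headVars a)[i]?.map (fun x => a.1.bodyVars.idxOf x) = some j ∧ j < a.1.bodyVars.length)

/-- `y` is a child of `x`. -/
def childF (R : RuleSet) (x y : ℕ) : MSO := .disj (symbols R) fun a => .child a.1 a.2 x y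

/-- `x` is the root. -/
def rootF (R : RuleSet) (x : ℕ) : MSO := .neg (.exNode 30 (childF R 30 x))

/-- `x` is an ancestor of `y`, or `y` itself. -/
def suffixF (R : RuleSet) (x y : ℕ) : MSO :=
  .allSet 1 (.imp (.mem x 1) (.imp
    (.allNode 30 (.allNode 31 (.imp (.mem 30 1) (.imp (childF R 30 31) (.mem 31 1)))))
    (.mem y 1)))

/-- The atom at `x` has predicate and number of terms as given by `p`. -/
def shapeF (c : RuleSet × Atom ℕ) (x : ℕ) (p : ℕ × ℕ) : MSO :=
  .or (.and (rootF c.1 x) (.const (decide ((c.2.1, c.2.2.length) = p))))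
    (.exNode 30 (.disj (symbols c.1) fun a =>
      .and (.const (decide (headShape a = p))) (.child a.1 a.2 30 x)))

/-- The conjunct of `closedF` for the positions `i` and `j`. -/
def closedAtF (c : RuleSet × Atom ℕ) (i j : ℕ) : MSO :=
  .and (.imp (.const (sameVar c.2.2 i c.2.2 j))
      (.imp (rootF c.1 20) (.imp (.mem 20 (i + 2)) (.mem 20 (j + 2)))))
    (.conj (symbols c.1) fun a => .and
      (.imp (.const (isCopy a i j))
        (.imp (.child a.1 a.2 20 21) (.iff (.mem 20 (j + 2)) (.mem 21 (i + 2)))))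
      (.conj (symbols c.1) fun b =>
        .imp (.const (decide (a.1 = b.1) && sameVar (headVars a) i (headVars b) j))
          (.imp (.child a.1 a.2 20 21) (.imp (.child b.1 b.2 20 22)
            (.imp (.mem 21 (i + 2)) (.mem 22 (j + 2)))))))

/-- The family of sets given by the set variables `2, 3, …` is closed, see `IsClosedFamily`. -/
def closedF (c : RuleSet × Atom ℕ) : MSO :=
  .allNode 20 (.allNode 21 (.allNode 22 (.conj (List.range (maxPos c)) fun i =>
    .conj (List.range (maxPos c)) fun j => closedAtF c i j)))

/-- The term at position `i` of `x` is equal to the term at position `j` of `y`. -/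
def termEqF (c : RuleSet × Atom ℕ) (x i y j : ℕ) : MSO :=
  .neg (.exSets (maxPos c) (.and (closedF c) (.and (.mem x (i + 2)) (.neg (.mem y (j + 2))))))

/-- The body of `ρ` matches the atom at `x`. -/
def bodyMatchF (c : RuleSet × Atom ℕ) (ρ : Rule) (x : ℕ) : MSO :=
  .and (.or (.const (decide (ρ.body = none))) (shapeF c x (bodyShape ρ)))
    (.conj (List.range (maxPos c)) fun i => .conj (List.range (maxPos c)) fun j =>
      .imp (.const (sameVar ρ.bodyVars i ρ.bodyVars j)) (termEqF c x i x j))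

/-- `x` is in the forest. -/
def forestF (c : RuleSet × Atom ℕ) (x : ℕ) : MSO :=
  .allNode 10 (.allNode 11 (.imp (suffixF c.1 11 x) (.conj (symbols c.1) fun a =>
    .imp (.child a.1 a.2 10 11) (bodyMatchF c a.1 10))))

/-- `1` and `2` form a blocking team for the trigger of the rule `ρ` at `0`. -/
def teamF (c : RuleSet × Atom ℕ) (ρ : Rule) : MSO :=
  .and (.conj [0, 1] fun ι : Fin 2 =>
      .and (forestF c (ι.val + 1)) (shapeF c (ι.val + 1) (headShape (ρ, ι))))
    (.conj (List.range (maxPos c)) fun i => .conj (List.range (maxPos c)) fun j =>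
      .conj [0, 1] fun ι : Fin 2 => .and
        (.imp (.const (isCopy (ρ, ι) i j)) (termEqF c 0 j (ι.val + 1) i))
        (.conj [0, 1] fun κ : Fin 2 =>
          .imp (.const (sameVar (headVars (ρ, ι)) i (headVars (ρ, κ)) j))
            (termEqF c (ι.val + 1) i (κ.val + 1) j)))

/-- The set `0` is an infinite path in the forest. -/
def pathF (c : RuleSet × Atom ℕ) : MSO :=
  .and (.allNode 10 (.imp (rootF c.1 10) (.mem 10 0)))
    (.and (.allNode 10 (.allNode 11 (.imp (childF c.1 10 11) (.imp (.mem 11 0) (.mem 10 0)))))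
      (.allNode 9 (.imp (.mem 9 0) (.and (forestF c 9)
        (.exNode 10 (.and (.and (childF c.1 9 10) (.mem 10 0))
          (.allNode 11 (.imp (.and (childF c.1 9 11) (.mem 11 0)) (.eq 11 10)))))))))

/-- `x` is the root, or a node of the path, or has the same parent and rule as a node of the
path. -/
def nearF (R : RuleSet) (x : ℕ) : MSO :=
  .or (rootF R x) (.exNode 10 (.exNode 11 (.disj (symbols R) fun a => .disj (symbols R) fun b =>
    .and (.const (decide (a.1 = b.1)))
      (.and (.child a.1 a.2 10 11) (.and (.mem 11 0) (.child b.1 b.2 10 x))))))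

/-- `x` is present when the trigger at `0` is applied, either for being near the path and not below
`0`, or for being `3` or `4` and `0` beyond `5`. -/
def presentF (R : RuleSet) (x : ℕ) : MSO :=
  .or (.and (nearF R x) (.neg (.and (suffixF R 0 x) (.neg (.eq 0 x)))))
    (.and (suffixF R 5 0) (.or (.eq x 3) (.eq x 4)))

/-- There is an infinite path on whose triggers no team of present nodes is blocking. -/
def pathExistsF (c : RuleSet × Atom ℕ) : MSO :=
  .exSet 0 (.and (pathF c) (.allNode 3 (.allNode 4 (.exNode 5 (.and (.mem 5 0)
    (.allNode 0 (.imp (.mem 0 0) (.allNode 1 (.allNode 2 (.conj (symbols c.1) fun a =>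
      .imp (.exNode 10 (.and (.mem 10 0) (.child a.1 a.2 0 10))) (.imp (teamF c a.1)
        (.neg (.and (presentF c.1 1) (presentF c.1 2))))))))))))))

/-- The sentence that expresses the existence of a sensitive-path-derivation. -/
def pathSentence (c : RuleSet × Atom ℕ) : MSO := (pathExistsF c).close

/-! ### The symbols of the sentence -/

theorem mem_symbols {R : RuleSet} {a : Rule × Fin 2} : a ∈ symbols R ↔ a.1 ∈ R := by
  obtain ⟨ρ, ι⟩ := a
  fin_cases ι <;> simp [symbols]

section IsOver

open MSO

variable {c : RuleSet × Atom ℕ}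

theorem isOver_childF {R : RuleSet} (x y : ℕ) : (childF R x y).IsOver R :=
  IsOver.conj fun _ ha => mem_symbols.1 ha

theorem isOver_rootF {R : RuleSet} (x : ℕ) : (rootF R x).IsOver R := isOver_childF 30 x

theorem isOver_suffixF {R : RuleSet} (x y : ℕ) : (suffixF R x y).IsOver R := by
  simp only [suffixF, MSO.allSet, MSO.allNode, MSO.imp, MSO.IsOver, isOver_childF, true_and]

theorem isOver_shapeF (x : ℕ) (p : ℕ × ℕ) : (shapeF c x p).IsOver c.1 := by
  simp only [shapeF, MSO.or, MSO.IsOver, isOver_rootF, isOver_const, true_and]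
  exact IsOver.conj fun _ ha => ⟨isOver_const _, mem_symbols.1 ha⟩

theorem isOver_closedF : (closedF c).IsOver c.1 := by
  refine IsOver.conj fun i _ => IsOver.conj fun j _ => ?_
  refine ⟨by simp [MSO.imp, MSO.IsOver, isOver_rootF, isOver_const], IsOver.conj fun a ha => ?_⟩
  rw [mem_symbols] at ha
  refine ⟨by simp [MSO.imp, MSO.iff, MSO.IsOver, isOver_const, ha], IsOver.conj fun b hb => ?_⟩
  rw [mem_symbols] at hb
  simp [MSO.imp, MSO.IsOver, isOver_const, ha, hb]

theorem isOver_termEqF (x i y j : ℕ) : (termEqF c x i y j).IsOver c.1 :=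
  IsOver.exSets (φ := .and (closedF c) (.and (.mem x (i + 2)) (.neg (.mem y (j + 2))))) _
    ⟨isOver_closedF, trivial, trivial⟩

theorem isOver_bodyMatchF (ρ : Rule) (x : ℕ) : (bodyMatchF c ρ x).IsOver c.1 := by
  refine ⟨⟨isOver_const _, isOver_shapeF _ _⟩, IsOver.conj fun i _ => IsOver.conj fun j _ => ?_⟩
  exact ⟨isOver_const _, isOver_termEqF _ _ _ _⟩

theorem isOver_forestF (x : ℕ) : (forestF c x).IsOver c.1 := by
  refine ⟨isOver_suffixF _ _, IsOver.conj fun a ha => ?_⟩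
  exact ⟨mem_symbols.1 ha, isOver_bodyMatchF _ _⟩

theorem isOver_teamF (ρ : Rule) : (teamF c ρ).IsOver c.1 := by
  refine ⟨IsOver.conj fun ι _ => ⟨isOver_forestF _, isOver_shapeF _ _⟩,
    IsOver.conj fun i _ => IsOver.conj fun j _ => IsOver.conj fun ι _ =>
      ⟨⟨isOver_const _, isOver_termEqF _ _ _ _⟩, IsOver.conj fun κ _ => ?_⟩⟩
  exact ⟨isOver_const _, isOver_termEqF _ _ _ _⟩

theorem isOver_pathF : (pathF c).IsOver c.1 := by
  simp [pathF, MSO.allNode, MSO.imp, MSO.IsOver, isOver_rootF, isOver_childF, isOver_forestF]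

theorem isOver_nearF {R : RuleSet} (x : ℕ) : (nearF R x).IsOver R := by
  simp only [nearF, MSO.or, MSO.disj, MSO.IsOver, isOver_rootF, true_and]
  refine IsOver.conj fun a ha => IsOver.conj fun b hb => ?_
  exact ⟨isOver_const _, mem_symbols.1 ha, trivial, mem_symbols.1 hb⟩

theorem isOver_presentF {R : RuleSet} (x : ℕ) : (presentF R x).IsOver R := by
  simp [presentF, MSO.or, MSO.IsOver, isOver_nearF, isOver_suffixF]

theorem isOver_pathSentence (c : RuleSet × Atom ℕ) : (pathSentence c).IsOver c.1 := by
  refine IsOver.close ?_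
  simp only [pathExistsF, MSO.allNode, MSO.imp, MSO.IsOver, isOver_pathF, true_and]
  refine IsOver.conj fun a ha => ?_
  simp [MSO.IsOver, mem_symbols.1 ha, isOver_teamF, isOver_presentF]

end IsOver

/-! ### The meaning of the formulas -/

section Semantics

open MSO

variable {R : RuleSet} {ω : Atom ℕ} {s : ℕ → Address R} {S : ℕ → Set (Address R)}

theorem forall_symbols {p : Rule × Fin 2 → Prop} :
    (∀ a ∈ symbols R, p a) ↔ ∀ a : Symb R, p (a.1.1, a.2) :=
  ⟨fun h a => h _ (mem_symbols.2 a.1.2), fun h a ha => h (⟨a.1, mem_symbols.1 ha⟩, a.2)⟩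

theorem exists_symbols {p : Rule × Fin 2 → Prop} :
    (∃ a ∈ symbols R, p a) ↔ ∃ a : Symb R, p (a.1.1, a.2) :=
  ⟨fun ⟨a, ha, h⟩ => ⟨(⟨a.1, mem_symbols.1 ha⟩, a.2), h⟩,
    fun ⟨a, h⟩ => ⟨_, mem_symbols.2 a.1.2, h⟩⟩

@[simp] theorem treeChild_symb {a : Symb R} {u v : Address R} :
    treeChild R a.1.1 a.2 u v ↔ v = a :: u :=
  ⟨fun ⟨_, h⟩ => h, fun h => ⟨a.1.2, h⟩⟩

@[simp] theorem sat_childF {x y : ℕ} :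
    Sat (treeChild R) s S (childF R x y) ↔ ∃ a, s y = a :: s x := by
  simp only [childF, sat_disj, exists_symbols, sat_child, treeChild_symb]

-- The bound keeps `x` apart from the bound variable `30`. The bounds `20` and `10` on variables
-- below serve the same purpose.
@[simp] theorem sat_rootF {x : ℕ} (hx : x < 30) :
    Sat (treeChild R) s S (rootF R x) ↔ s x = [] := by
  simp only [rootF, sat_neg, sat_exNode, sat_childF, Function.update_self,
    Function.update_of_ne hx.ne]
  cases s x <;> simp

-- The descendants of `x` form the least set containing `x` and closed under children. The node
-- variables `30` and `31` are bound only in the closure clause, where `x` and `y` do not occur, so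
-- no bound on them is needed.
@[simp] theorem sat_suffixF {x y : ℕ} :
    Sat (treeChild R) s S (suffixF R x y) ↔ s x <:+ s y := by
  simp only [suffixF, sat_allSet, sat_imp, sat_mem, sat_allNode, sat_childF, Function.update_self,
    Function.update_of_ne (show (30 : ℕ) ≠ 31 by decide)]
  constructor
  · intro H
    refine H {v | s x <:+ v} List.suffix_rfl fun u v hu => ?_
    rintro ⟨a, rfl⟩
    exact List.IsSuffix.trans hu (List.suffix_cons _ _)
  · rintro ⟨t, ht⟩ A hA hc
    rw [← ht]
    clear ht
    induction t with
    | nil => exact hA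
    | cons a t ih => exact hc _ _ ih ⟨a, rfl⟩

theorem shape_cons {a : Symb R} {u : Address R} :
    shape ω (a :: u) = headShape (a.1.1, a.2) := rfl

@[simp] theorem sat_shapeF {x : ℕ} (hx : x < 30) {p : ℕ × ℕ} :
    Sat (treeChild R) s S (shapeF (R, ω) x p) ↔ shape ω (s x) = p := by
  simp only [shapeF, sat_or, sat_and, sat_rootF hx, sat_const, decide_eq_true_eq, sat_exNode,
    sat_disj, exists_symbols, sat_child, treeChild_symb, Function.update_self,
    Function.update_of_ne hx.ne]
  cases s x with
  | nil => simp [shape]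
  | cons a u =>
    simp only [reduceCtorEq, false_and, false_or, List.cons.injEq, shape_cons]
    constructor
    · rintro ⟨v, b, h, rfl, -⟩
      exact h
    · exact fun h => ⟨u, a, h, rfl, rfl⟩

/-! ### Equality of terms through closed families -/

/-- A family of sets of addresses, of which the `i`-th set is thought of as the set of addresses
whose `i`-th term belongs to some set of terms. -/
def IsClosedFamily (K : ℕ) (ω : Atom ℕ) (A : ℕ → Set (Address R)) : Prop :=
  ∀ i < K, ∀ j < K, (sameVar ω.2 i ω.2 j → [] ∈ A i → [] ∈ A j) ∧
    ∀ a : Symb R, (isCopy (a.1.1, a.2) i j → ∀ p, p ∈ A j ↔ a :: p ∈ A i) ∧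
      ∀ b : Symb R, a.1 = b.1 → sameVar (headVars (a.1.1, a.2)) i (headVars (b.1.1, b.2)) j →
        ∀ p, a :: p ∈ A i → b :: p ∈ A j

theorem sat_closedF : Sat (treeChild R) s S (closedF (R, ω)) ↔
    IsClosedFamily (maxPos (R, ω)) ω fun k => S (k + 2) := by
  simp only [closedF, closedAtF, sat_allNode, sat_conj, List.mem_range, sat_and, sat_imp, sat_const,
    sat_rootF (show 20 < 30 by decide), sat_mem, forall_symbols, sat_child, treeChild_symb, sat_iff,
    Bool.and_eq_true, decide_eq_true_eq, Function.update_self, ne_eq, Nat.reduceEqDiff,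
    not_false_eq_true, Function.update_of_ne, IsClosedFamily, Subtype.val_inj]
  constructor
  · intro H i hi j hj
    refine ⟨fun h1 h2 => (H [] [] [] i hi j hj).1 h1 rfl h2, fun a => ⟨fun h p => ?_,
      fun b h1 h2 p h3 => ?_⟩⟩
    · exact ((H p (a :: p) [] i hi j hj).2 a).1 h rfl
    · exact ((H p (a :: p) (b :: p) i hi j hj).2 a).2 b ⟨h1, h2⟩ rfl rfl h3
  · intro H p q r i hi j hj
    obtain ⟨h1, h2⟩ := H i hi j hj
    refine ⟨?_, fun a => ⟨?_, ?_⟩⟩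
    · rintro h rfl
      exact h1 h
    · rintro h rfl
      exact (h2 a).1 h p
    · rintro b ⟨h, h'⟩ rfl rfl
      exact (h2 a).2 b h h' p

theorem sameVar_iff {l l' : List ℕ} {i j : ℕ} :
    sameVar l i l' j = true ↔ ∃ x, l[i]? = some x ∧ l'[j]? = some x := by
  simp only [sameVar, decide_eq_true_eq, Option.ne_none_iff_exists']
  constructor
  · rintro ⟨⟨x, hx⟩, h⟩
    exact ⟨x, hx, h ▸ hx⟩
  · rintro ⟨x, hx, h⟩
    exact ⟨⟨x, hx⟩, hx.trans h.symm⟩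

theorem isCopy_iff {a : Rule × Fin 2} {i j : ℕ} : isCopy a i j = true ↔
    ∃ x, (a.1.head a.2).2[i]? = some x ∧ x ∈ a.1.bodyVars ∧ a.1.bodyVars.idxOf x = j := by
  simp only [isCopy, headVars, decide_eq_true_eq, Option.map_eq_some_iff]
  constructor
  · rintro ⟨⟨x, hx, rfl⟩, h⟩
    exact ⟨x, hx, List.idxOf_lt_length_iff.1 h, rfl⟩
  · rintro ⟨x, hx, h, rfl⟩
    exact ⟨⟨x, hx, rfl⟩, List.idxOf_lt_length_iff.2 h⟩

theorem length_le_maxPos : ω.2.length ≤ maxPos (R, ω) ∧ ∀ ρ ∈ R,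
    ρ.bodyVars.length ≤ maxPos (R, ω) ∧ ∀ ι, (ρ.head ι).2.length ≤ maxPos (R, ω) := by
  simp only [Fin.forall_fin_two]
  induction R with
  | nil => simp [maxPos]
  | cons ρ R ih =>
    have h : maxPos (ρ :: R, ω) = ρ.bodyVars.length + (ρ.head 0).2.length + (ρ.head 1).2.length +
      maxPos (R, ω) := rfl
    refine ⟨by omega, List.forall_mem_cons.2 ⟨by omega, fun σ hσ => ?_⟩⟩
    have := ih.2 σ hσ
    omega

theorem lt_maxPos_of_termAt {u : Address R} {i : ℕ} {t : Term R} (h : termAt ω u i = some t) :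
    i < maxPos (R, ω) := by
  obtain ⟨h1, h2⟩ := length_le_maxPos (R := R) (ω := ω)
  by_contra hi
  cases u with
  | nil => simp [termAt, List.getElem?_eq_none (show ω.2.length ≤ i by omega)] at h
  | cons a u =>
    have := (h2 _ a.1.2).2 a.2
    simp [termAt, List.getElem?_eq_none (show (a.1.1.head a.2).2.length ≤ i by omega)] at h

/-- The occurrences of one term form the closed family that separates it from all other terms. -/
theorem isClosedFamily_termAt (K : ℕ) (t : Term R) :
    IsClosedFamily K ω fun k => {u : Address R | termAt ω u k = some t} := by
  intro i hi j hj
  simp only [sameVar_iff, isCopy_iff, Set.mem_ofPred_eq]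
  refine ⟨?_, fun a => ⟨?_, ?_⟩⟩
  · rintro ⟨x, h1, h2⟩ h
    simpa [termAt, h1, h2] using h
  · rintro ⟨x, h1, h2, rfl⟩ p
    rw [termAt_cons h1, if_pos h2]
  · rintro ⟨ρ, κ⟩ h ⟨x, h1, h2⟩ p h3
    subst h
    rw [termAt_cons h1] at h3
    rw [termAt_cons h2, h3]

/-- A term belongs to the set of terms that a closed family describes. -/
def InFamily (ω : Atom ℕ) (A : ℕ → Set (Address R)) : Term R → Prop
  | .const c => ∃ i, ω.2[i]? = some c ∧ [] ∈ A i
  | .null z ρ u => ∃ ι k, (ρ.1.head ι).2[k]? = some z ∧ (ρ, ι) :: u ∈ A k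

/-- Each occurrence is traced upwards to its origin: a constant at the root, or an existential
variable in the head of the creating rule. Copying preserves membership both ways, and the origins
of one term are linked by the root and sibling clauses, so membership depends on the term alone. -/
theorem IsClosedFamily.mem_iff {A : ℕ → Set (Address R)}
    (hA : IsClosedFamily (maxPos (R, ω)) ω A) {u : Address R} {t : Term R} :
    ∀ {i : ℕ}, termAt ω u i = some t → (u ∈ A i ↔ InFamily ω A t) := by
  obtain ⟨hl, hl'⟩ := length_le_maxPos (R := R) (ω := ω)
  have hlt : ∀ {l : List ℕ} {i x : ℕ}, l.length ≤ maxPos (R, ω) → l[i]? = some x →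
      i < maxPos (R, ω) := fun h h' => (List.getElem?_eq_some_iff.1 h').1.trans_le h
  induction u with
  | nil =>
    intro i h
    simp only [termAt, Option.map_eq_some_iff] at h
    obtain ⟨c, hc, rfl⟩ := h
    refine ⟨fun h => ⟨i, hc, h⟩, fun ⟨j, hj, h⟩ => ?_⟩
    exact (hA j (hlt hl hj) i (hlt hl hc)).1 (sameVar_iff.2 ⟨c, hj, hc⟩) h
  | cons a u ih =>
    obtain ⟨ρ, ι⟩ := a
    intro i h
    have hlρ := (hl' ρ.1 ρ.2).2
    obtain ⟨x, hx⟩ : ∃ x, (ρ.1.head ι).2[i]? = some x := by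
      cases hx : (ρ.1.head ι).2[i]? with
      | none => simp [termAt, hx] at h
      | some x => exact ⟨x, rfl⟩
    have hi := hlt (hlρ ι) hx
    rw [termAt_cons hx] at h
    split_ifs at h with hb
    · rw [← ih h]
      have hj := List.idxOf_lt_length_of_mem hb
      exact (((hA i hi _ (hj.trans_le (hl' ρ.1 ρ.2).1)).2 (ρ, ι)).1
        (isCopy_iff.2 ⟨x, hx, hb, rfl⟩) u).symm
    · simp only [Option.some.injEq] at h
      subst h
      refine ⟨fun h => ⟨ι, i, hx, h⟩, fun ⟨κ, k, hk, h⟩ => ?_⟩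
      exact ((hA k (hlt (hlρ κ) hk) i hi).2 (ρ, κ)).2 (ρ, ι) rfl (sameVar_iff.2 ⟨x, hk, hx⟩) u h

/-- One implication between memberships suffices, because the family of occurrences of `t` itself is
tested. That the first term exists and that `j` is in range makes both set variables ones that
`exSets` quantifies. -/
theorem sat_termEqF {x i y j : ℕ} {t : Term R} (ht : termAt ω (s x) i = some t)
    (hj : j < maxPos (R, ω)) : Sat (treeChild R) s S (termEqF (R, ω) x i y j) ↔
      termAt ω (s x) i = termAt ω (s y) j := by
  have hi := lt_maxPos_of_termAt ht
  simp only [termEqF, sat_neg, sat_exSets, sat_and, sat_closedF, sat_mem, Set.mem_Ico,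
    Nat.add_sub_cancel, not_exists, not_and, not_not]
  have e : ∀ (A : ℕ → Set (Address R)) k, k < maxPos (R, ω) →
      (if 2 ≤ k + 2 ∧ k + 2 < maxPos (R, ω) + 2 then A k else S (k + 2)) = A k := fun A k hk =>
    if_pos (by omega)
  have hc : ∀ A : ℕ → Set (Address R), IsClosedFamily (maxPos (R, ω)) ω (fun k =>
      if 2 ≤ k + 2 ∧ k + 2 < maxPos (R, ω) + 2 then A k else S (k + 2)) ↔
      IsClosedFamily (maxPos (R, ω)) ω A := fun A => by
    unfold IsClosedFamily
    refine forall₂_congr fun i hi => forall₂_congr fun j hj => ?_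
    simp only [e A _ hi, e A _ hj]
  simp only [hc, e _ _ hi, e _ _ hj, ht]
  constructor
  · exact fun H => (H _ (isClosedFamily_termAt _ t) ht).symm
  · exact fun h A hA hx => (hA.mem_iff h.symm).2 ((hA.mem_iff ht).1 hx)

/-! ### Matching, the forest and blocking teams in MSO -/

theorem exists_termAt {u : Address R} {i : ℕ} (hα : label R ω u ≠ none)
    (hi : i < (shape ω u).2) : ∃ t, termAt ω u i = some t := by
  obtain ⟨α, hα⟩ := Option.ne_none_iff_exists'.1 hα
  obtain ⟨h1, h2⟩ := label_eq_some hα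
  rw [h1] at hi
  exact ⟨α.2[i], by rw [← h2, List.getElem?_eq_getElem hi]⟩

theorem BodyMatch.length_bodyVars {ρ : Rule} {u : Address R}
    (h : ∀ β ∈ ρ.body, shape ω u = (β.1, β.2.length)) : ρ.bodyVars.length ≤ (shape ω u).2 := by
  unfold Rule.bodyVars
  cases hb : ρ.body with
  | none => simp
  | some β => simp [h β hb]

theorem sat_bodyMatchF {ρ : Rule} (hρ : ρ ∈ R) {x : ℕ} (hx : x < 20)
    (h : label R ω (s x) ≠ none) :
    Sat (treeChild R) s S (bodyMatchF (R, ω) ρ x) ↔ BodyMatch ω ρ (s x) := by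
  obtain ⟨-, hl⟩ := length_le_maxPos (R := R) (ω := ω)
  have hl := (hl ρ hρ).1
  simp only [bodyMatchF, sat_and, sat_or, sat_const, decide_eq_true_eq,
    sat_shapeF (show x < 30 by omega), sat_conj, List.mem_range, sat_imp, BodyMatch]
  have h1 : (ρ.body = none ∨ shape ω (s x) = bodyShape ρ) ↔
      ∀ β ∈ ρ.body, shape ω (s x) = (β.1, β.2.length) := by
    unfold bodyShape
    cases ρ.body <;> simp
  rw [h1]
  refine and_congr_right fun hs => ?_
  have hlen := BodyMatch.length_bodyVars hs
  have key : ∀ {i j}, sameVar ρ.bodyVars i ρ.bodyVars j = true → j < maxPos (R, ω) ∧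
      ∃ t, termAt ω (s x) i = some t := fun {i j} hij => by
    obtain ⟨y, h1, h2⟩ := sameVar_iff.1 hij
    have h1 := (List.getElem?_eq_some_iff.1 h1).1
    have h2 := (List.getElem?_eq_some_iff.1 h2).1
    exact ⟨by omega, exists_termAt h (by omega)⟩
  constructor
  · intro H i j hi hij
    have hv : sameVar ρ.bodyVars i ρ.bodyVars j = true := by simp [sameVar, hij ▸ hi, hij]
    obtain ⟨hj, t, ht⟩ := key hv
    exact (sat_termEqF ht hj).1 (H i (lt_maxPos_of_termAt ht) j hj hv)
  · intro H i hi j hj hv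
    obtain ⟨-, t, ht⟩ := key hv
    rw [sat_termEqF ht hj]
    simp only [sameVar, decide_eq_true_eq] at hv
    exact H i j hv.1 hv.2

-- An address is in the forest iff the body matches along every edge leading to it. The induction
-- runs down the word, since `sat_bodyMatchF` is available only at parents already known to be in
-- the forest.
@[simp] theorem sat_forestF {x : ℕ} (hx : x < 10) :
    Sat (treeChild R) s S (forestF (R, ω) x) ↔ label R ω (s x) ≠ none := by
  have h : ∀ p (a : Symb R), Sat (treeChild R)
      (Function.update (Function.update s 10 p) 11 (a :: p)) S (suffixF R 11 x) ↔ a :: p <:+ s x :=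
    fun p a => by
      rw [sat_suffixF, Function.update_self,
        Function.update_of_ne (by omega), Function.update_of_ne (by omega)]
  have h' : Sat (treeChild R) s S (forestF (R, ω) x) ↔ ∀ p (a : Symb R), a :: p <:+ s x →
      Sat (treeChild R) (Function.update (Function.update s 10 p) 11 (a :: p)) S
        (bodyMatchF (R, ω) a.1.1 10) := by
    simp only [forestF, sat_allNode, sat_imp, sat_conj, forall_symbols, sat_child, treeChild_symb,
      Function.update_self, Function.update_of_ne (show (10 : ℕ) ≠ 11 by decide)]
    constructor
    · exact fun H p a hp => H p (a :: p) ((h p a).2 hp) a rfl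
    · rintro H p q hq a rfl
      exact H p a ((h p a).1 hq)
  have hb : ∀ p (a : Symb R), label R ω p ≠ none → (Sat (treeChild R)
      (Function.update (Function.update s 10 p) 11 (a :: p)) S (bodyMatchF (R, ω) a.1.1 10) ↔
        BodyMatch ω a.1.1 p) := fun p a hp => by
    rw [sat_bodyMatchF a.1.2 (by decide)] <;>
      rw [Function.update_of_ne (by decide), Function.update_self]
    exact hp
  rw [h']
  generalize s x = v
  induction v with
  | nil => simp [label]
  | cons a u ih =>
    refine Iff.trans ?_ label_cons_ne_none_iff.symm
    constructor
    · intro H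
      have H' := fun p b hp => H p b (List.IsSuffix.trans hp (List.suffix_cons _ _))
      exact ⟨ih.1 H', (hb u a (ih.1 H')).1 (H u a List.suffix_rfl)⟩
    · rintro ⟨h1, h2⟩ p b hp
      rcases List.suffix_cons_iff.1 hp with hp | hp
      · obtain ⟨rfl, rfl⟩ := List.cons.inj hp
        exact (hb p b h1).2 h2
      · exact ih.2 h1 p b hp

theorem sat_teamF {ρ : {ρ : Rule // ρ ∈ R}} (h : IsTrigger R ω (ρ, s 0)) :
    Sat (treeChild R) s S (teamF (R, ω) ρ.1) ↔
      IsBlockingTeam R ω (ρ, s 0) fun ι => s (ι.val + 1) := by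
  obtain ⟨-, hl⟩ := length_le_maxPos (R := R) (ω := ω)
  obtain ⟨hlb, hlh⟩ := hl ρ.1 ρ.2
  have hF : ∀ p : Fin 2 → Prop, (∀ b ∈ [(0 : Fin 2), 1], p b) ↔ ∀ b, p b := fun p => by
    simp [Fin.forall_fin_two]
  have hlt : ∀ ι : Fin 2, ι.val + 1 < 10 := fun ι => by omega
  have hlt' : ∀ ι : Fin 2, ι.val + 1 < 30 := fun ι => by omega
  simp only [isBlockingTeam_iff h, teamF, sat_and, sat_conj, hF, sat_forestF (hlt _),
    sat_shapeF (hlt' _), List.mem_range, sat_imp, sat_const]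
  -- With forest membership and shapes granted, every position compared below carries a term, as
  -- `sat_termEqF` requires.
  refine and_congr_right fun hs => ?_
  obtain ⟨hu, hb⟩ := label_cons_ne_none_iff.1 ((isTrigger_iff 0).1 h)
  have hlen := BodyMatch.length_bodyVars hb.1
  have hcopy : ∀ {ι i j}, isCopy (ρ.1, ι) i j = true → i < maxPos (R, ω) ∧
      ∃ t, termAt ω (s 0) j = some t := fun {ι i j} hc => by
    obtain ⟨x, hx, hxb, rfl⟩ := isCopy_iff.1 hc
    have hi := (List.getElem?_eq_some_iff.1 hx).1
    have hj := List.idxOf_lt_length_of_mem hxb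
    exact ⟨hi.trans_le (hlh ι), exists_termAt hu (hj.trans_le hlen)⟩
  have hsame : ∀ {ι κ i j}, sameVar (headVars (ρ.1, ι)) i (headVars (ρ.1, κ)) j = true →
      j < maxPos (R, ω) ∧ ∃ t, termAt ω (s (ι.val + 1)) i = some t := fun {ι κ i j} hc => by
    obtain ⟨x, h1, h2⟩ := sameVar_iff.1 hc
    have h1 := (List.getElem?_eq_some_iff.1 h1).1
    have h2 := (List.getElem?_eq_some_iff.1 h2).1
    exact ⟨h2.trans_le (hlh κ), exists_termAt (hs ι).1 (by rw [(hs ι).2]; exact h1)⟩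
  constructor
  · intro H
    refine ⟨fun ι k x hx hxb => ?_, fun ι κ k l hk hkl => ?_⟩
    · have hc : isCopy (ρ.1, ι) k (ρ.1.bodyVars.idxOf x) = true := isCopy_iff.2 ⟨x, hx, hxb, rfl⟩
      obtain ⟨hk, t, ht⟩ := hcopy hc
      exact (sat_termEqF ht hk).1 ((H k hk _ (lt_maxPos_of_termAt ht) ι).1 hc)
    · have hc : sameVar (headVars (ρ.1, ι)) k (headVars (ρ.1, κ)) l = true := by
        obtain ⟨x, hx⟩ := Option.ne_none_iff_exists'.1 hk
        exact sameVar_iff.2 ⟨x, hx, hkl ▸ hx⟩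
      obtain ⟨hl, t, ht⟩ := hsame hc
      exact (sat_termEqF ht hl).1 ((H k (lt_maxPos_of_termAt ht) l hl ι).2 κ hc)
  · rintro ⟨h1, h2⟩ i hi j hj ι
    refine ⟨fun hc => ?_, fun κ hc => ?_⟩
    · obtain ⟨-, t, ht⟩ := hcopy hc
      rw [sat_termEqF ht hi]
      obtain ⟨x, hx, hxb, rfl⟩ := isCopy_iff.1 hc
      exact h1 ι i x hx hxb
    · obtain ⟨-, t, ht⟩ := hsame hc
      rw [sat_termEqF ht hj]
      obtain ⟨x, hx, hx'⟩ := sameVar_iff.1 hc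
      exact h2 ι κ i j (Option.ne_none_iff_exists'.2 ⟨x, hx⟩) (hx.trans hx'.symm)

/-! ### Unblocked paths -/

/-- `A` is an infinite path in the forest. -/
def IsForestPath (R : RuleSet) (ω : Atom ℕ) (A : Set (Address R)) : Prop :=
  [] ∈ A ∧ (∀ a u, a :: u ∈ A → u ∈ A) ∧
    ∀ u ∈ A, label R ω u ≠ none ∧ ∃ a, a :: u ∈ A ∧ ∀ b, b :: u ∈ A → b = a

/-- The root and all nodes that share parent and rule with a node of `A`. -/
def nearby {R : RuleSet} (A : Set (Address R)) : Set (Address R) :=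
  {v | v = [] ∨ ∃ ρ ι κ p, (ρ, ι) :: p ∈ A ∧ v = (ρ, κ) :: p}

/-- The addresses that count as present when the trigger at `u` is applied: those near `A` and not
below `u`, and moreover `v` and `v'` if `u` is beyond `p`. -/
def present {R : RuleSet} (A : Set (Address R)) (v v' p u : Address R) : Set (Address R) :=
  {x | x ∈ nearby A ∧ ¬ (u <:+ x ∧ u ≠ x) ∨ p <:+ u ∧ (x = v ∨ x = v')}

/-- `A` is an infinite path in the forest on whose triggers no team of present addresses is
blocking. -/
def IsUnblockedPath (R : RuleSet) (ω : Atom ℕ) (A : Set (Address R)) : Prop :=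
  IsForestPath R ω A ∧ ∀ v v', ∃ p ∈ A, ∀ u ∈ A, ∀ ρ ι, (ρ, ι) :: u ∈ A →
    ∀ x, IsBlockingTeam R ω (ρ, u) x → ¬ ∀ κ, x κ ∈ present A v v' p u

theorem sat_pathF : Sat (treeChild R) s S (pathF (R, ω)) ↔ IsForestPath R ω (S 0) := by
  simp only [pathF, sat_and, sat_allNode, sat_imp, sat_rootF (show 10 < 30 by decide), sat_mem,
    sat_childF, sat_exNode, sat_eq, sat_forestF (show 9 < 10 by decide), Function.update_self, ne_eq,
    Nat.reduceEqDiff, not_false_eq_true, Function.update_of_ne, IsForestPath]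
  refine and_congr (by simp) (and_congr ?_ (forall₂_congr fun u hu => and_congr_right fun _ => ?_))
  · constructor
    · exact fun H a u h => H u _ ⟨a, rfl⟩ h
    · rintro H u _ ⟨a, rfl⟩ h
      exact H a u h
  · constructor
    · rintro ⟨_, ⟨⟨a, rfl⟩, h1⟩, h2⟩
      exact ⟨a, h1, fun b hb => (List.cons.inj (h2 _ ⟨⟨b, rfl⟩, hb⟩)).1⟩
    · rintro ⟨a, h1, h2⟩
      refine ⟨_, ⟨⟨a, rfl⟩, h1⟩, ?_⟩
      rintro _ ⟨⟨b, rfl⟩, h⟩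
      rw [h2 b h]

theorem sat_nearF {x : ℕ} (hx : x < 10) :
    Sat (treeChild R) s S (nearF R x) ↔ s x ∈ nearby (S 0) := by
  simp only [nearF, sat_or, sat_rootF (show x < 30 by omega), sat_exNode, sat_disj, exists_symbols,
    sat_and, sat_const, sat_child, treeChild_symb, sat_mem, Function.update_self,
    Function.update_of_ne (show x ≠ 11 by omega), Function.update_of_ne (show x ≠ 10 by omega),
    Function.update_of_ne (show (10 : ℕ) ≠ 11 by decide), decide_eq_true_eq, Subtype.val_inj, nearby,
    Set.mem_ofPred_eq]
  refine or_congr_right ⟨?_, ?_⟩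
  · rintro ⟨p, _, ⟨ρ, ι⟩, ⟨_, κ⟩, rfl, rfl, h1, h2⟩
    exact ⟨ρ, ι, κ, p, h1, h2⟩
  · rintro ⟨ρ, ι, κ, p, h1, h2⟩
    exact ⟨p, _, (ρ, ι), (ρ, κ), rfl, rfl, h1, h2⟩

theorem sat_presentF {x : ℕ} (hx : x < 10) : Sat (treeChild R) s S (presentF R x) ↔
    s x ∈ present (S 0) (s 3) (s 4) (s 5) (s 0) := by
  simp only [presentF, sat_or, sat_and, sat_neg, sat_nearF hx, sat_suffixF, sat_eq, present,
    Set.mem_ofPred_eq, ne_eq]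

theorem sat_pathExistsF :
    Sat (treeChild R) s S (pathExistsF (R, ω)) ↔ ∃ A, IsUnblockedPath R ω A := by
  simp only [pathExistsF, sat_exSet, sat_and, sat_pathF, Function.update_self]
  refine exists_congr fun A => and_congr_right fun hA => ?_
  simp only [sat_allNode, sat_exNode, sat_and, sat_imp, sat_mem, sat_conj, forall_symbols, sat_child,
    sat_neg, treeChild_symb, sat_presentF (show 1 < 10 by decide),
    sat_presentF (show 2 < 10 by decide), Function.update_self, ne_eq, zero_ne_one,
    OfNat.ofNat_ne_zero, OfNat.ofNat_ne_one, OfNat.zero_ne_ofNat, OfNat.one_ne_ofNat,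
    Nat.reduceEqDiff, not_false_eq_true, Function.update_of_ne]
  refine forall₂_congr fun v v' => exists_congr fun p => and_congr_right fun _ =>
    forall₂_congr fun u hu => ?_
  -- `teamF` has its meaning only at triggers; here the next node of the path lies in the forest, so
  -- its rule does give a trigger at `u`.
  have key : ∀ {ρ : {ρ : Rule // ρ ∈ R}} {ι : Fin 2} (_ : (ρ, ι) :: u ∈ A) (x : Fin 2 → Address R)
      (s' : ℕ → Address R), s' 0 = u → s' 1 = x 0 → s' 2 = x 1 →
      (Sat (treeChild R) s' (Function.update S 0 A) (teamF (R, ω) ρ.1) ↔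
        IsBlockingTeam R ω (ρ, u) x) := by
    intro ρ ι h x s' h0 h1 h2
    have hx : (fun ι : Fin 2 => s' (ι.val + 1)) = x := by
      funext κ
      fin_cases κ
      · exact h1
      · exact h2
    rw [sat_teamF, hx, h0]
    rw [h0]
    exact (isTrigger_iff ι).2 (hA.2.2 _ h).1
  constructor
  · intro H ρ ι h x hx hp
    refine H (x 0) (x 1) (ρ, ι) ⟨_, h, rfl⟩ ((key h x _ ?_ ?_ ?_).2 hx) ⟨hp 0, hp 1⟩ <;>
      simp
  · rintro H x y ⟨ρ, ι⟩ ⟨_, h, rfl⟩ hx hp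
    refine H ρ ι h ![x, y] ((key h _ _ ?_ ?_ ?_).1 hx) (Fin.forall_fin_two.2 hp) <;>
      simp

theorem treeModels_pathSentence :
    TreeModels R (pathSentence (R, ω)) ↔ ∃ A, IsUnblockedPath R ω A := by
  have h := sat_close (rel := treeChild R) (φ := pathExistsF (R, ω)) fun s S =>
    sat_pathExistsF (s := s) (S := S)
  exact ⟨fun H => (h (fun _ => []) (fun _ => ∅)).1 (H _ _), fun H s S => (h s S).2 H⟩

end Semantics

/-! ### Derivations and paths -/

section Derivations

variable {R : RuleSet} {ω : Atom ℕ} {M : ℕ → Trigger R}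

theorem mem_step {n : ℕ} {v : Address R} :
    v ∈ step M n ↔ v = [] ∨ ∃ i < n, ∃ ι, v = ((M i).1, ι) :: (M i).2 := by
  induction n with
  | zero => simp [step]
  | succ n ih =>
    rw [step, Set.mem_union, ih]
    constructor
    · rintro (⟨ι, h⟩ | h | ⟨i, hi, h⟩)
      · exact .inr ⟨n, n.lt_succ_self, ι, h⟩
      · exact .inl h
      · exact .inr ⟨i, by omega, h⟩
    · rintro (h | ⟨i, hi, ι, h⟩)
      · exact .inr (.inl h)
      · rcases Nat.lt_succ_iff_lt_or_eq.1 hi with hi | rfl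
        · exact .inr (.inr ⟨i, hi, ι, h⟩)
        · exact .inl ⟨ι, h⟩

theorem cons_mem_step {n : ℕ} {ρ : {ρ : Rule // ρ ∈ R}} {ι : Fin 2} {u : Address R} :
    (ρ, ι) :: u ∈ step M n ↔ ∃ i < n, M i = (ρ, u) := by
  rw [mem_step]
  constructor
  · rintro (h | ⟨i, hi, κ, h⟩)
    · cases h
    · simp only [List.cons.injEq, Prod.mk.injEq] at h
      exact ⟨i, hi, Prod.ext h.1.1.symm h.2.symm⟩
  · rintro ⟨i, hi, h⟩
    exact .inr ⟨i, hi, ι, by rw [h]⟩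

theorem step_mono : Monotone (step M) :=
  monotone_nat_of_le_succ fun _ => Set.subset_union_right

theorem IsDerivation.mem_of_suffix (hM : IsDerivation R ω M) {n : ℕ} {u v : Address R}
    (h : u <:+ v) (hv : v ∈ step M n) : u ∈ step M n := by
  obtain ⟨t, rfl⟩ := h
  induction t with
  | nil => exact hv
  | cons a t ih =>
    obtain ⟨ρ, ι⟩ := a
    obtain ⟨i, hi, h⟩ := cons_mem_step.1 hv
    have := (hM i).2.1
    rw [h] at this
    exact ih (step_mono hi.le this)

/-- Each trigger deepens the tree by at most one level. This ties time to depth: a trigger at depth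
`n` is applied at step `n` or later. -/
theorem IsDerivation.length_le (hM : IsDerivation R ω M) {n : ℕ} {u : Address R}
    (h : u ∈ step M n) : u.length ≤ n := by
  induction n using Nat.strong_induction_on generalizing u with
  | _ n ih =>
    rcases mem_step.1 h with rfl | ⟨i, hi, ι, rfl⟩
    · simp
    · have := ih i hi (hM i).2.1
      simp only [List.length_cons]
      omega

/-- For given `v`, `v'`, the node `p` is the path node at a depth not below the steps of `M` by
which they have appeared. Any team of addresses counted as present would then really block a trigger
of `P` in `M`. -/
theorem IsSensitivePathDerivation.exists_isUnblockedPath {P : ℕ → Trigger R}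
    (D : IsSensitivePathDerivation R ω M P) : ∃ A, IsUnblockedPath R ω A := by
  obtain ⟨f, -, hf⟩ := D.subsequence
  obtain ⟨w, hw0, hw, hA⟩ := D.path
  have hlen : ∀ n, (w n).length = n := fun n => by
    induction n with
    | zero => simp [hw0]
    | succ n ih =>
      obtain ⟨a, ha⟩ := hw n
      simp [ha, ih]
  have hchain : ∀ {i j}, i ≤ j → w i <:+ w j := fun {i j} hij => by
    induction j, hij using Nat.le_induction with
    | base => exact List.suffix_rfl
    | succ j _ ih =>
      obtain ⟨a, ha⟩ := hw j
      rw [ha]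
      exact ih.trans (List.suffix_cons _ _)
  have htrig : ∀ {u}, u ∈ Set.range w → ∃ ρ k, P k = (ρ, u) := fun {u} hu => by
    rw [← hA] at hu
    exact hu
  -- Some trigger of `P` is active at the next node, so that node was created within `P`,
  -- necessarily by `(ρ, u)`.
  have hcons : ∀ {ρ ι u}, (ρ, ι) :: u ∈ Set.range w → ∃ k, P k = (ρ, u) := fun {ρ ι u} hu => by
    obtain ⟨ρ', k, hk⟩ := htrig hu
    have := (D.derivation' k).2.1
    rw [hk] at this
    obtain ⟨i, -, hi⟩ := cons_mem_step.1 this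
    exact ⟨i, hi⟩
  have hforest : ∀ v, ∃ N, v ∈ forest R ω → v ∈ step M N := fun v => by
    by_cases hv : v ∈ forest R ω
    · rw [← D.oblivious] at hv
      obtain ⟨N, hN⟩ := Set.mem_iUnion.1 hv
      exact ⟨N, fun _ => hN⟩
    · exact ⟨0, fun h => absurd h hv⟩
  refine ⟨Set.range w, ⟨⟨0, hw0⟩, ?_, ?_⟩, fun v v' => ?_⟩
  · rintro a u ⟨n, hn⟩
    cases n with
    | zero => simp [hw0] at hn
    | succ n =>
      obtain ⟨b, hb⟩ := hw n
      rw [hb] at hn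
      exact ⟨n, (List.cons.inj hn).2⟩
  · rintro _ ⟨n, rfl⟩
    refine ⟨?_, ?_⟩
    · obtain ⟨ρ, k, hk⟩ := htrig ⟨n, rfl⟩
      obtain ⟨α, hα, -⟩ := (D.derivation' k).1
      rw [hk] at hα
      simp [hα]
    · obtain ⟨a, ha⟩ := hw n
      refine ⟨a, ⟨_, ha⟩, ?_⟩
      rintro b ⟨k, hk⟩
      have h1 := hlen k
      rw [hk, List.length_cons, hlen] at h1
      rw [← h1, ha] at hk
      exact (List.cons.inj hk).1.symm
  · obtain ⟨N, hN⟩ := hforest v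
    obtain ⟨N', hN'⟩ := hforest v'
    refine ⟨w (max N N'), ⟨_, rfl⟩, ?_⟩
    rintro u hu ρ ι hρ x hx hp
    obtain ⟨k, hk⟩ := hcons hρ
    have hM : M (f k) = (ρ, u) := by rw [← hf, hk]
    have hu' := (D.derivation (f k)).2.1
    have htr := (D.derivation (f k)).1
    rw [hM] at hu' htr
    refine D.not_blocked (f k) ⟨k, hf k⟩ ⟨x, fun κ => ?_, hM ▸ hx⟩
    obtain ⟨n, rfl⟩ := hu
    rcases hp κ with ⟨rfl' | ⟨σ, ι', κ', q, hq, he⟩, hnot⟩ | ⟨hs, he⟩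
    · rw [rfl']
      exact mem_step.2 (.inl rfl)
    · rw [he] at hnot ⊢
      obtain ⟨j, hj⟩ := hq
      have hj' := hlen j
      rw [hj, List.length_cons] at hj'
      -- A path node up to `u` was present together with `u`, hence so was its sibling, an output of
      -- the same trigger; a later one has its siblings strictly below `u`, which is excluded.
      by_cases hjn : j ≤ n
      · have := D.derivation.mem_of_suffix (hchain hjn) hu'
        rw [hj, cons_mem_step] at this
        exact cons_mem_step.2 this
      · refine absurd ⟨?_, ?_⟩ hnot
        · have hs := hchain (show n ≤ j by omega)
          rw [hj, List.suffix_cons_iff] at hs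
          rcases hs with hs | hs
          · have := hlen n
            rw [hs, List.length_cons] at this
            omega
          · exact hs.trans (List.suffix_cons _ _)
        · intro h
          have := hlen n
          rw [h, List.length_cons] at this
          omega
    · have hle := hs.length_le
      have h2 := D.derivation.length_le hu'
      rw [hlen, hlen] at hle
      rw [hlen] at h2
      -- Team members lie in the forest because their labels are images of the labels of the
      -- trigger's outputs; so `v`, `v'` matter only if they get created at all.
      have hxf : x κ ∈ forest R ω := by
        obtain ⟨h, -, hh⟩ := hx
        have := (isTrigger_iff κ).1 htr
        change label R ω (x κ) ≠ none
        rw [← hh κ]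
        simpa using this
      rcases he with he | he
      · rw [he] at hxf ⊢
        exact step_mono (by omega) (hN hxf)
      · rw [he] at hxf ⊢
        exact step_mono (by omega) (hN' hxf)

/-- An injective ranking of the triggers that respects the tree order gives an oblivious derivation
in which the triggers are applied in the order of their ranks. -/
theorem exists_isOblivious {key : Trigger R → ℕ} (hinj : Function.Injective key)
    (hkey : ∀ ρ ι u ρ', key (ρ, u) < key (ρ', (ρ, ι) :: u)) (hT : {π | IsTrigger R ω π}.Infinite) :
    ∃ M : ℕ → Trigger R, IsDerivation R ω M ∧ IsOblivious R ω M ∧ StrictMono (key ∘ M) ∧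
      ∀ π, IsTrigger R ω π → ∃ n, M n = π := by
  have : Infinite (key '' {π | IsTrigger R ω π}) := (hT.image hinj.injOn).to_subtype
  classical
  -- The ranks form an infinite set of naturals; listing it increasingly lists all triggers.
  let e := Nat.Subtype.orderIsoOfNat (key '' {π | IsTrigger R ω π})
  choose M hMT hM using fun n => (e n).2
  have hmono : StrictMono (key ∘ M) := fun i j hij => by
    simp only [Function.comp_apply, hM]
    exact e.strictMono hij
  have hsurj : ∀ π, IsTrigger R ω π → ∃ n, M n = π := fun π hπ => by
    obtain ⟨n, hn⟩ := e.surjective ⟨key π, π, hπ, rfl⟩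
    exact ⟨n, hinj (by rw [hM, hn])⟩
  refine ⟨M, fun n => ⟨hMT n, ?_, fun h => ?_⟩, ?_, hmono, hsurj⟩
  · obtain ⟨α, hα, -⟩ := hMT n
    rcases hu : (M n).2 with _ | ⟨⟨ρ, ι⟩, u⟩
    · exact mem_step.2 (.inl rfl)
    · have ht : IsTrigger R ω (ρ, u) := (isTrigger_iff ι).2 (by rw [← hu, hα]; simp)
      obtain ⟨i, hi⟩ := hsurj _ ht
      refine cons_mem_step.2 ⟨i, hmono.lt_iff_lt.1 ?_, hi⟩
      have := hkey ρ ι u (M n).1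
      rw [← hu] at this
      simpa only [Function.comp_apply, hi] using this
  · obtain ⟨i, hi, h'⟩ := cons_mem_step.1 (h ⟨0, rfl⟩)
    have := hmono hi
    simp [h'] at this
  · ext v
    simp only [Set.mem_iUnion]
    rcases v with _ | ⟨⟨ρ, ι⟩, u⟩
    · exact ⟨fun _ => by simp [forest, label], fun _ => ⟨0, rfl⟩⟩
    · simp only [cons_mem_step]
      change _ ↔ label R ω _ ≠ none
      rw [← isTrigger_iff]
      constructor
      · rintro ⟨n, i, -, h⟩
        exact h ▸ hMT i
      · intro h
        obtain ⟨i, hi⟩ := hsurj _ h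
        exact ⟨i + 1, i, i.lt_succ_self, hi⟩

/-- An injective numbering of the triggers that respects the tree order. -/
def triggerCode (π : Trigger R) : ℕ := Encodable.encode ((π.1, 0) :: π.2 : Address R)

theorem triggerCode_injective : Function.Injective (triggerCode (R := R)) := fun π π' h => by
  have := Encodable.encode_injective h
  simp only [List.cons.injEq, Prod.mk.injEq, and_true] at this
  exact Prod.ext this.1 this.2

/-- The code uses the least head index `0`, so it is at most the code of any address the trigger
creates; that address is the tail of the list coding the later trigger. -/
theorem triggerCode_lt (ρ : {ρ : Rule // ρ ∈ R}) (ι : Fin 2) (u : Address R)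
    (ρ' : {ρ : Rule // ρ ∈ R}) : triggerCode (ρ, u) < triggerCode (ρ', (ρ, ι) :: u) := by
  have h1 : triggerCode (ρ, u) ≤ Encodable.encode ((ρ, ι) :: u : Address R) := by
    simp only [triggerCode, Encodable.encode_list_cons, Nat.succ_eq_add_one, add_le_add_iff_right]
    have hl : ∀ b, StrictMono fun a => Nat.pair a b := fun b _ _ h => Nat.pair_lt_pair_left b h
    have hr : ∀ a, StrictMono (Nat.pair a) := fun a _ _ h => Nat.pair_lt_pair_right a h
    refine (hl _).monotone ?_
    simp only [Encodable.encode_prod_val]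
    exact (hr _).monotone (Nat.zero_le _)
  refine h1.trans_lt ?_
  rw [triggerCode, Encodable.encode_list_cons]
  exact Nat.lt_succ_of_le (Nat.right_le_pair _ _)

theorem length_le_triggerCode (π : Trigger R) : π.2.length ≤ triggerCode π :=
  (Nat.le_succ _).trans (Encodable.length_le_encode ((π.1, (0 : Fin 2)) :: π.2))

/-- The number of the trigger that creates an address. -/
def creatorCode : Address R → ℕ
  | [] => 0
  | (ρ, _) :: u => triggerCode (ρ, u)

theorem finite_creatorCode_le (m : ℕ) : {v : Address R | creatorCode v ≤ m}.Finite := by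
  have h : {π : Trigger R | triggerCode π ≤ m}.Finite :=
    (Set.finite_Iic m).preimage triggerCode_injective.injOn
  refine ((Set.finite_singleton []).union
    ((h.prod (Set.finite_univ (α := Fin 2))).image fun q => (q.1.1, q.2) :: q.1.2)).subset ?_
  rintro (_ | ⟨⟨ρ, ι⟩, u⟩) hv
  · exact .inl rfl
  · exact .inr ⟨((ρ, u), ι), ⟨hv, trivial⟩, rfl⟩

/-- Only finitely many pairs have creator codes at most `m`; partial sums of their bounds, plus `m`,
increase strictly. `G` serves as the delay of the off-path triggers. -/
theorem exists_strictMono_bound (N : Address R → Address R → ℕ) :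
    ∃ G : ℕ → ℕ, StrictMono G ∧ ∀ v v' m, creatorCode v ≤ m → creatorCode v' ≤ m → N v v' ≤ G m := by
  have : ∀ m, ∃ B, ∀ v v', creatorCode v ≤ m → creatorCode v' ≤ m → N v v' ≤ B := fun m => by
    obtain ⟨B, hB⟩ := (((finite_creatorCode_le (R := R) m).prod (finite_creatorCode_le m)).image
      fun q => N q.1 q.2).bddAbove
    exact ⟨B, fun v v' h h' => hB ⟨(v, v'), ⟨h, h'⟩, rfl⟩⟩
  choose B hB using this
  refine ⟨fun m => m + ∑ i ∈ Finset.range (m + 1), B i, strictMono_nat_of_lt_succ fun m => ?_,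
    fun v v' m h h' => (hB m v v' h h').trans ?_⟩
  · rw [Finset.sum_range_succ _ (m + 1)]
    omega
  · simp only [Finset.sum_range_succ _ m]
    omega

/-- Following the unique child inside `A` from the root reaches every node of `A`, at the index
equal to its depth. -/
theorem IsForestPath.exists_enumeration {A : Set (Address R)} (hA : IsForestPath R ω A) :
    ∃ w : ℕ → Address R, w 0 = [] ∧ (∀ n, ∃ a, w (n + 1) = a :: w n) ∧ (∀ n, w n ∈ A) ∧
      ∀ v ∈ A, w v.length = v := by
  obtain ⟨h0, h1, h2⟩ := hA
  choose c hc hc' using fun u : A => (h2 u.1 u.2).2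
  let w : ℕ → A := fun n => n.rec ⟨[], h0⟩ fun _ u => ⟨c u :: u.1, hc u⟩
  have hw : ∀ n, (w (n + 1)).1 = c (w n) :: (w n).1 := fun n => rfl
  refine ⟨fun n => (w n).1, rfl, fun n => ⟨_, hw n⟩, fun n => (w n).2, fun v hv => ?_⟩
  induction v with
  | nil => rfl
  | cons a u ih =>
    have hu : (w u.length).1 = u := ih (h1 a u hv)
    simp only [List.length_cons, hw]
    rw [hu]
    congr 1
    refine (hc' (w u.length) a ?_).symm
    rwa [hu]

/-- Path triggers run in order of depth, and an off-path trigger waits until the path has passed all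
nodes `p` that its outputs may require. A team that blocked a path trigger would then consist of
addresses counted by `present`. -/
theorem IsUnblockedPath.exists_isSensitivePathDerivation {A : Set (Address R)}
    (hA : IsUnblockedPath R ω A) :
    ∃ M P : ℕ → Trigger R, IsSensitivePathDerivation R ω M P := by
  classical
  obtain ⟨hpath, hA⟩ := hA
  choose p hpA hp using hA
  obtain ⟨w, hw0, hw, hwA, hAw⟩ := hpath.exists_enumeration
  have hlen : ∀ n, (w n).length = n := fun n => by
    induction n with
    | zero => simp [hw0]
    | succ n ih =>
      obtain ⟨a, ha⟩ := hw n
      simp [ha, ih]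
  have hchain : ∀ {i j}, i ≤ j → w i <:+ w j := fun {i j} hij => by
    induction j, hij using Nat.le_induction with
    | base => exact List.suffix_rfl
    | succ j _ ih =>
      obtain ⟨a, ha⟩ := hw j
      rw [ha]
      exact ih.trans (List.suffix_cons _ _)
  choose a ha using hw
  let P : ℕ → Trigger R := fun n => ((a n).1, w n)
  have hPlen : ∀ n, (P n).2.length = n := hlen
  have hwP : ∀ n, w (n + 1) = ((P n).1, (a n).2) :: (P n).2 := ha
  have hPT : ∀ n, IsTrigger R ω (P n) := fun n => by
    refine (isTrigger_iff (a n).2).2 ?_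
    rw [← hwP]
    exact (hpath.2.2 _ (hwA _)).1
  obtain ⟨G, hG, hGp⟩ := exists_strictMono_bound fun v v' => (p v v').length
  -- Parity separates the two kinds of triggers. An off-path trigger precedes the path trigger at
  -- depth `n` iff its delay is below `n`.
  let key : Trigger R → ℕ := fun π =>
    if π ∈ Set.range P then 2 * π.2.length else 2 * G (triggerCode π) + 1
  have hkeyP : ∀ n, key (P n) = 2 * n := fun n => by
    simp only [key, if_pos (Set.mem_range_self n), hPlen]
  have hkeyN : ∀ {π}, π ∉ Set.range P → key π = 2 * G (triggerCode π) + 1 := fun {π} h => if_neg h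
  have hinj : Function.Injective key := fun π π' h => by
    by_cases h1 : π ∈ Set.range P <;> by_cases h2 : π' ∈ Set.range P
    · obtain ⟨n, rfl⟩ := h1
      obtain ⟨m, rfl⟩ := h2
      rw [hkeyP, hkeyP] at h
      rw [show n = m by omega]
    · obtain ⟨n, rfl⟩ := h1
      rw [hkeyP, hkeyN h2] at h
      omega
    · obtain ⟨n, rfl⟩ := h2
      rw [hkeyP, hkeyN h1] at h
      omega
    · rw [hkeyN h1, hkeyN h2] at h
      exact triggerCode_injective (hG.injective (by omega))
  have hkey : ∀ ρ ι u ρ', key (ρ, u) < key (ρ', (ρ, ι) :: u) := fun ρ ι u ρ' => by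
    -- If the lower trigger is on the path, so is the upper one. Otherwise the code of the lower one
    -- exceeds that of the upper one and is at least its own depth, and `G m ≥ m`.
    by_cases h2 : (ρ', (ρ, ι) :: u) ∈ Set.range P
    · obtain ⟨n, hn⟩ := h2
      have h3 : w n = (ρ, ι) :: u := congrArg Prod.snd hn
      cases n with
      | zero => simp [hw0] at h3
      | succ n =>
        rw [hwP, List.cons.injEq, Prod.mk.injEq] at h3
        have h4 : P n = (ρ, u) := Prod.ext h3.1.1 h3.2
        rw [← hn, ← h4, hkeyP, hkeyP]
        omega
    · rw [hkeyN h2]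
      have h3 := triggerCode_lt ρ ι u ρ'
      by_cases h1 : (ρ, u) ∈ Set.range P
      · have h4 := length_le_triggerCode (ρ', (ρ, ι) :: u)
        have h5 := hG.id_le (triggerCode (ρ', (ρ, ι) :: u))
        simp only [key, if_pos h1, List.length_cons, id_eq] at h4 h5 ⊢
        omega
      · rw [hkeyN h1]
        have := hG h3
        omega
  have hPinj : Function.Injective P := fun n m h => by rw [← hPlen n, ← hPlen m, h]
  obtain ⟨M, hM, hMo, hMk, hMs⟩ := exists_isOblivious hinj hkey
    ((Set.infinite_range_of_injective hPinj).mono (by rintro _ ⟨n, rfl⟩; exact hPT n))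
  choose f hf using fun n => hMs _ (hPT n)
  have hfm : StrictMono f := fun i j hij => by
    rw [← hMk.lt_iff_lt]
    simp only [Function.comp_apply, hf, hkeyP]
    omega
  have hsub : ∀ n, step P n ⊆ step M (f n) := fun n => by
    rintro (_ | ⟨⟨ρ, ι⟩, u⟩) h
    · exact mem_step.2 (.inl rfl)
    · obtain ⟨i, hi, h⟩ := cons_mem_step.1 h
      exact cons_mem_step.2 ⟨f i, hfm hi, by rw [hf, h]⟩
  have hnb : ∀ m, M m ∈ Set.range P → ¬ IsBlocked R ω (M m) (step M m) := by
    rintro m ⟨n, hn⟩ ⟨x, hxm, hx⟩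
    rw [← hn] at hx
    have hwn : ((P n).1, (a n).2) :: w n ∈ A := by
      have := hwA (n + 1)
      rwa [hwP] at this
    -- A present address is the root, or an output of a path trigger above depth `n` and so not
    -- below `w n`, or an output of an off-path trigger with delay below `n`.
    have hcases : ∀ κ, (x κ ∈ nearby A ∧ ¬ (w n <:+ x κ ∧ w n ≠ x κ)) ∨
        G (creatorCode (x κ)) < n := fun κ => by
      rcases hxκ : x κ with _ | ⟨⟨ρ, ι⟩, u⟩
      · exact .inl ⟨.inl rfl, fun h => h.2 (List.suffix_nil.1 h.1)⟩
      · have h := hxm κ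
        rw [hxκ] at h
        obtain ⟨i, hi, hi'⟩ := cons_mem_step.1 h
        have hlt := hMk hi
        simp only [Function.comp_apply, ← hn, hkeyP, hi'] at hlt
        by_cases hP : (ρ, u) ∈ Set.range P
        · obtain ⟨j, hj⟩ := hP
          rw [← hj, hkeyP] at hlt
          refine .inl ⟨.inr ⟨ρ, (a j).2, ι, u, ?_, rfl⟩, fun hs => hs.2 (hs.1.eq_of_length ?_)⟩
          · have := hwA (j + 1)
            rwa [hwP, hj] at this
          · have h1 := hs.1.length_le
            have h2 := hPlen j
            rw [hj] at h2
            rw [List.length_cons] at h1 ⊢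
            rw [hlen] at h1 ⊢
            simp only at h2
            omega
        · rw [hkeyN hP] at hlt
          refine .inr ?_
          change G (triggerCode (ρ, u)) < n
          omega
    have hsuf : ∀ v v' m, creatorCode v ≤ m → creatorCode v' ≤ m → G m < n → p v v' <:+ w n :=
      fun v v' m h h' hm => by
        rw [← hAw _ (hpA v v')]
        exact hchain ((hGp v v' m h h').trans hm.le)
    have hfin : ∀ v v', (∀ κ, x κ ∈ present A v v' (p v v') (w n)) → False := fun v v' h =>
      hp v v' (w n) (hwA n) _ _ hwn x hx h
    -- The pair `v`, `v'` consists of the off-path members: one is doubled if it is alone, and any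
    -- pair will do if there is none.
    rcases hcases 0 with h0 | h0 <;> rcases hcases 1 with h1 | h1
    · exact hfin [] [] (Fin.forall_fin_two.2 ⟨.inl h0, .inl h1⟩)
    · exact hfin (x 1) (x 1) (Fin.forall_fin_two.2
        ⟨.inl h0, .inr ⟨hsuf _ _ _ le_rfl le_rfl h1, .inl rfl⟩⟩)
    · exact hfin (x 0) (x 0) (Fin.forall_fin_two.2
        ⟨.inr ⟨hsuf _ _ _ le_rfl le_rfl h0, .inl rfl⟩, .inl h1⟩)
    · have hs : p (x 0) (x 1) <:+ w n :=
        hsuf _ _ (max (creatorCode (x 0)) (creatorCode (x 1))) (le_max_left _ _) (le_max_right _ _)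
          (by rcases max_choice (creatorCode (x 0)) (creatorCode (x 1)) with h | h <;> rwa [h])
      exact hfin (x 0) (x 1) (Fin.forall_fin_two.2 ⟨.inr ⟨hs, .inl rfl⟩, .inr ⟨hs, .inr rfl⟩⟩)
  refine ⟨M, P, hM, hMo, fun n => ⟨hPT n, ?_, fun h => ?_⟩, fun n => ?_, ⟨f, hfm, fun n => (hf n).symm⟩,
    hnb, w, hw0, fun n => ⟨_, ha n⟩, ?_⟩
  · cases n with
    | zero => exact mem_step.2 (.inl hw0)
    | succ n =>
      change w (n + 1) ∈ _
      rw [hwP]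
      exact cons_mem_step.2 ⟨n, n.lt_succ_self, rfl⟩
  · obtain ⟨i, hi, h'⟩ := cons_mem_step.1 (h ⟨0, rfl⟩)
    exact hi.ne (hPinj h')
  · rintro ⟨x, hx, hb⟩
    -- `P` has created less than `M` when the same trigger is applied, so a block in `P` would be a
    -- block in `M`.
    refine hnb (f n) (by rw [hf]; exact ⟨n, rfl⟩) ⟨x, fun κ => hsub n (hx κ), ?_⟩
    rwa [hf]
  · ext u
    constructor
    · rintro ⟨ρ, n, hn⟩
      exact ⟨n, congrArg Prod.snd hn⟩
    · rintro ⟨n, rfl⟩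
      exact ⟨_, n, rfl⟩

end Derivations

/-! ### Computability of the sentence -/

section Computability

open MSO Primrec

variable {α β : Type} [Primcodable α] [Primcodable β]

theorem primrec_iff_toNat {f : α → MSO} : Primrec f ↔ Primrec fun a => (f a).toNat :=
  (Primrec.of_equiv_iff equivNat).symm

theorem primrec_tag {f : α → ℕ} (hf : Primrec f) (m : ℕ) : Primrec fun a => 8 * f a + m :=
  Primrec.nat_add.comp (Primrec.nat_mul.comp (Primrec.const 8) hf) (Primrec.const m)

/-! ### Primitive recursiveness of the formula constructors -/

section Constructors

variable {f g : α → MSO} {x y : α → ℕ}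

theorem primrec_mem (hx : Primrec x) (hy : Primrec y) : Primrec fun a => MSO.mem (x a) (y a) :=
  primrec_iff_toNat.2 (primrec_tag (Primrec₂.natPair.comp hx hy) 3)

theorem primrec_neg (hf : Primrec f) : Primrec fun a => MSO.neg (f a) :=
  primrec_iff_toNat.2 (primrec_tag (primrec_iff_toNat.1 hf) 4)

theorem primrec_and (hf : Primrec f) (hg : Primrec g) : Primrec fun a => MSO.and (f a) (g a) :=
  primrec_iff_toNat.2 (primrec_tag (Primrec₂.natPair.comp (primrec_iff_toNat.1 hf)
    (primrec_iff_toNat.1 hg)) 5)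

theorem primrec_exNode (hx : Primrec x) (hf : Primrec f) :
    Primrec fun a => MSO.exNode (x a) (f a) :=
  primrec_iff_toNat.2 (primrec_tag (Primrec₂.natPair.comp hx (primrec_iff_toNat.1 hf)) 6)

theorem primrec_exSet (hx : Primrec x) (hf : Primrec f) :
    Primrec fun a => MSO.exSet (x a) (f a) :=
  primrec_iff_toNat.2 (primrec_tag (Primrec₂.natPair.comp hx (primrec_iff_toNat.1 hf)) 7)

theorem primrec_child {b : α → Rule × Fin 2} (hb : Primrec b) (hx : Primrec x) (hy : Primrec y) :
    Primrec fun a => MSO.child (b a).1 (b a).2 (x a) (y a) := by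
  refine primrec_iff_toNat.2 (Primrec.nat_add.comp (primrec_tag (Primrec₂.natPair.comp
    (Primrec.encode.comp (Primrec.fst.comp hb)) (Primrec₂.natPair.comp hx hy)) 0)
    (Primrec.nat_add.comp (Primrec.const 1) (Primrec.fin_val.comp (Primrec.snd.comp hb))))

theorem primrec_or (hf : Primrec f) (hg : Primrec g) : Primrec fun a => MSO.or (f a) (g a) :=
  primrec_neg (primrec_and (primrec_neg hf) (primrec_neg hg))

theorem primrec_imp (hf : Primrec f) (hg : Primrec g) : Primrec fun a => MSO.imp (f a) (g a) :=
  primrec_neg (primrec_and hf (primrec_neg hg))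

theorem primrec_iff (hf : Primrec f) (hg : Primrec g) : Primrec fun a => MSO.iff (f a) (g a) :=
  primrec_and (primrec_imp hf hg) (primrec_imp hg hf)

theorem primrec_allNode (hx : Primrec x) (hf : Primrec f) :
    Primrec fun a => MSO.allNode (x a) (f a) :=
  primrec_neg (primrec_exNode hx (primrec_neg hf))

theorem primrec_allSet (hx : Primrec x) (hf : Primrec f) :
    Primrec fun a => MSO.allSet (x a) (f a) :=
  primrec_neg (primrec_exSet hx (primrec_neg hf))

theorem primrec_const {b : α → Bool} (hb : Primrec b) : Primrec fun a => MSO.const (b a) :=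
  Primrec.cond hb (Primrec.const _) (Primrec.const _)

theorem primrec_conj {l : α → List β} {h : α → β → MSO} (hl : Primrec l)
    (hh : Primrec fun q : α × β => h q.1 q.2) : Primrec fun a => MSO.conj (l a) (h a) :=
  Primrec.list_foldr hl (Primrec.const tt) (primrec_and
    (hh.comp (Primrec.pair Primrec.fst (Primrec.fst.comp Primrec.snd)))
    (Primrec.snd.comp Primrec.snd)).to₂

theorem primrec_disj {l : α → List β} {h : α → β → MSO} (hl : Primrec l)
    (hh : Primrec fun q : α × β => h q.1 q.2) : Primrec fun a => MSO.disj (l a) (h a) :=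
  primrec_neg (primrec_conj hl (primrec_neg hh))

theorem primrec_exSets (hx : Primrec x) (hf : Primrec f) :
    Primrec fun a => MSO.exSets (x a) (f a) :=
  Primrec.nat_rec' hx hf (primrec_exSet
    (Primrec.nat_add.comp (Primrec.fst.comp Primrec.snd) (Primrec.const 2))
    (Primrec.snd.comp Primrec.snd)).to₂

theorem primrec_close (hf : Primrec f) : Primrec fun a => MSO.close (f a) := by
  unfold MSO.close
  exact Primrec.nat_rec' (Primrec.succ.comp (primrec_iff_toNat.1 hf)) hf (primrec_exNode
    (Primrec.fst.comp Primrec.snd) (primrec_exSet (Primrec.fst.comp Primrec.snd)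
      (Primrec.snd.comp Primrec.snd))).to₂

end Constructors

/-! ### Primitive recursiveness of the rule data -/

theorem primrec_body : Primrec Rule.body := Primrec.fst

theorem primrec_head : Primrec fun a : Rule × Fin 2 => a.1.head a.2 := by
  have h : Primrec fun a : Rule × Fin 2 => if a.2 = 0 then a.1.2.1 else a.1.2.2 :=
    Primrec.ite (Primrec.eq.comp Primrec.snd (Primrec.const 0))
      (Primrec.fst.comp (Primrec.snd.comp Primrec.fst))
      (Primrec.snd.comp (Primrec.snd.comp Primrec.fst))
  refine h.of_eq fun ⟨ρ, ι⟩ => ?_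
  fin_cases ι <;> rfl

theorem primrec_headVars : Primrec headVars := Primrec.snd.comp primrec_head

theorem primrec_headShape : Primrec headShape :=
  Primrec.pair (Primrec.fst.comp primrec_head) (Primrec.list_length.comp primrec_headVars)

theorem primrec_bodyVars : Primrec Rule.bodyVars :=
  (Primrec.option_casesOn primrec_body (Primrec.const [])
    (Primrec.snd.comp Primrec.snd).to₂).of_eq fun ρ => by
      unfold Rule.bodyVars
      cases ρ.body <;> rfl

theorem primrec_bodyShape : Primrec bodyShape :=
  (Primrec.option_casesOn primrec_body (Primrec.const (0, 0))
    (Primrec.pair (Primrec.fst.comp Primrec.snd)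
      (Primrec.list_length.comp (Primrec.snd.comp Primrec.snd))).to₂).of_eq fun ρ => by
      unfold bodyShape
      cases ρ.body <;> rfl

theorem primrec_symbols : Primrec symbols :=
  Primrec.list_flatMap Primrec.id (Primrec.list_cons.comp
    (Primrec.pair Primrec.snd (Primrec.const 0)) (Primrec.list_cons.comp
      (Primrec.pair Primrec.snd (Primrec.const 1)) (Primrec.const []))).to₂

theorem primrec_maxPos : Primrec maxPos := by
  have h : ∀ ι : Fin 2, Primrec fun q : (RuleSet × Atom ℕ) × Rule × ℕ =>
      (q.2.1.head ι).2.length := fun ι => Primrec.list_length.comp (primrec_headVars.comp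
    (Primrec.pair (Primrec.fst.comp Primrec.snd) (Primrec.const ι)))
  exact Primrec.list_foldr Primrec.fst (Primrec.list_length.comp (Primrec.snd.comp Primrec.snd))
    (Primrec.nat_add.comp (Primrec.nat_add.comp (Primrec.nat_add.comp (Primrec.list_length.comp
      (primrec_bodyVars.comp (Primrec.fst.comp Primrec.snd))) (h 0)) (h 1))
      (Primrec.snd.comp Primrec.snd)).to₂

theorem primrec_decide_eq [DecidableEq β] {f g : α → β} (hf : Primrec f) (hg : Primrec g) :
    Primrec fun a => decide (f a = g a) :=
  (primrecPred_iff_primrec_decide.1 (Primrec.eq.comp hf hg)).of_eq fun a => by congr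

theorem primrec_sameVar {l l' : α → List ℕ} {i j : α → ℕ} (hl : Primrec l) (hi : Primrec i)
    (hl' : Primrec l') (hj : Primrec j) : Primrec fun a => sameVar (l a) (i a) (l' a) (j a) := by
  have h1 := Primrec.list_getElem?.comp hl hi
  have h2 := Primrec.list_getElem?.comp hl' hj
  refine (Primrec.and.comp (Primrec.not.comp (primrec_decide_eq h1 (Primrec.const none)))
    (primrec_decide_eq h1 h2)).of_eq fun a => ?_
  rw [sameVar, Bool.decide_and, decide_not]

theorem primrec_isCopy {b : α → Rule × Fin 2} {i j : α → ℕ} (hb : Primrec b) (hi : Primrec i)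
    (hj : Primrec j) : Primrec fun a => isCopy (b a) (i a) (j a) := by
  have hv := primrec_bodyVars.comp (Primrec.fst.comp hb)
  have h1 := Primrec.list_getElem?.comp (primrec_headVars.comp hb) hi
  have h2 : Primrec fun a => (headVars (b a))[i a]?.map fun x => (b a).1.bodyVars.idxOf x :=
    Primrec.option_map h1 (Primrec.list_idxOf.comp Primrec.snd (hv.comp Primrec.fst)).to₂
  refine (Primrec.and.comp (primrec_decide_eq h2 (Primrec.option_some.comp hj))
    (primrecPred_iff_primrec_decide.1
      (Primrec.nat_lt.comp hj (Primrec.list_length.comp hv)))).of_eq fun a => ?_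
  simp [isCopy]

/-! ### Primitive recursiveness of the parts of the sentence -/

section Formulas

variable {R : α → RuleSet} {c : α → RuleSet × Atom ℕ} {ρ : α → Rule} {b : α → Rule × Fin 2}
  {p : α → ℕ × ℕ} {x y i j : α → ℕ}

theorem primrec_childF (hR : Primrec R) (hx : Primrec x) (hy : Primrec y) :
    Primrec fun a => childF (R a) (x a) (y a) :=
  primrec_disj (primrec_symbols.comp hR)
    (primrec_child Primrec.snd (hx.comp Primrec.fst) (hy.comp Primrec.fst))

theorem primrec_rootF (hR : Primrec R) (hx : Primrec x) : Primrec fun a => rootF (R a) (x a) :=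
  primrec_neg (primrec_exNode (Primrec.const 30) (primrec_childF hR (Primrec.const 30) hx))

theorem primrec_suffixF (hR : Primrec R) (hx : Primrec x) (hy : Primrec y) :
    Primrec fun a => suffixF (R a) (x a) (y a) :=
  primrec_allSet (.const 1) (primrec_imp (primrec_mem hx (.const 1)) (primrec_imp
    (primrec_allNode (.const 30) (primrec_allNode (.const 31) (primrec_imp (.const _)
      (primrec_imp (primrec_childF hR (.const 30) (.const 31)) (.const _)))))
    (primrec_mem hy (.const 1))))

theorem primrec_shapeF (hc : Primrec c) (hx : Primrec x) (hp : Primrec p) :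
    Primrec fun a => shapeF (c a) (x a) (p a) :=
  primrec_or (primrec_and (primrec_rootF (Primrec.fst.comp hc) hx) (primrec_const
      (primrec_decide_eq (Primrec.pair (Primrec.fst.comp (Primrec.snd.comp hc))
        (Primrec.list_length.comp (Primrec.snd.comp (Primrec.snd.comp hc)))) hp)))
    (primrec_exNode (.const 30) (primrec_disj (primrec_symbols.comp (Primrec.fst.comp hc))
      (primrec_and (primrec_const (primrec_decide_eq (primrec_headShape.comp Primrec.snd)
        (hp.comp Primrec.fst))) (primrec_child Primrec.snd (.const 30) (hx.comp Primrec.fst)))))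

theorem primrec_conj_positions {h : α → ℕ → ℕ → MSO} (hc : Primrec c)
    (hh : Primrec fun q : (α × ℕ) × ℕ => h q.1.1 q.1.2 q.2) :
    Primrec fun a => MSO.conj (List.range (maxPos (c a))) fun i =>
      MSO.conj (List.range (maxPos (c a))) fun j => h a i j :=
  have hr := Primrec.list_range.comp (primrec_maxPos.comp hc)
  primrec_conj hr (primrec_conj (hr.comp Primrec.fst) hh)

/-- The two-element conjunction is unfolded, so each index is a fixed parameter and no recursiveness
in it is needed. -/
theorem primrec_conj_fin_two {h : α → Fin 2 → MSO} (hh : ∀ ι, Primrec fun a => h a ι) :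
    Primrec fun a => MSO.conj [0, 1] (h a) :=
  primrec_and (hh 0) (primrec_and (hh 1) (.const tt))

theorem primrec_closedAtF (hc : Primrec c) (hi : Primrec i) (hj : Primrec j) :
    Primrec fun a => closedAtF (c a) (i a) (j a) := by
  have hω : Primrec fun a => (c a).2.2 := Primrec.snd.comp (Primrec.snd.comp hc)
  have hs : Primrec fun a => symbols (c a).1 := primrec_symbols.comp (Primrec.fst.comp hc)
  have hi2 : Primrec fun a => i a + 2 := Primrec.nat_add.comp hi (.const 2)
  have hj2 : Primrec fun a => j a + 2 := Primrec.nat_add.comp hj (.const 2)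
  refine primrec_and (primrec_imp (primrec_const (primrec_sameVar hω hi hω hj))
    (primrec_imp (primrec_rootF (Primrec.fst.comp hc) (.const 20))
      (primrec_imp (primrec_mem (.const 20) hi2) (primrec_mem (.const 20) hj2))))
    (primrec_conj hs (primrec_and (primrec_imp (primrec_const (primrec_isCopy Primrec.snd
        (hi.comp Primrec.fst) (hj.comp Primrec.fst)))
        (primrec_imp (primrec_child Primrec.snd (.const 20) (.const 21))
          (primrec_iff (primrec_mem (.const 20) (hj2.comp Primrec.fst))
            (primrec_mem (.const 21) (hi2.comp Primrec.fst)))))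
      (primrec_conj (hs.comp Primrec.fst) ?_)))
  have ha : Primrec fun q : (α × Rule × Fin 2) × Rule × Fin 2 => q.1.2 :=
    Primrec.snd.comp Primrec.fst
  have hf : Primrec fun q : (α × Rule × Fin 2) × Rule × Fin 2 => q.1.1 :=
    Primrec.fst.comp Primrec.fst
  exact primrec_imp (primrec_const (Primrec.and.comp
      (primrec_decide_eq (Primrec.fst.comp ha) (Primrec.fst.comp Primrec.snd))
      (primrec_sameVar (primrec_headVars.comp ha) (hi.comp hf)
        (primrec_headVars.comp Primrec.snd) (hj.comp hf))))
    (primrec_imp (primrec_child ha (.const 20) (.const 21))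
      (primrec_imp (primrec_child Primrec.snd (.const 20) (.const 22))
        (primrec_imp (primrec_mem (.const 21) (hi2.comp hf))
          (primrec_mem (.const 22) (hj2.comp hf)))))

theorem primrec_closedF (hc : Primrec c) : Primrec fun a => closedF (c a) :=
  primrec_allNode (.const 20) (primrec_allNode (.const 21) (primrec_allNode (.const 22)
    (primrec_conj_positions hc (primrec_closedAtF (hc.comp (Primrec.fst.comp Primrec.fst))
      (Primrec.snd.comp Primrec.fst) Primrec.snd))))

theorem primrec_termEqF (hc : Primrec c) (hx : Primrec x) (hi : Primrec i) (hy : Primrec y)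
    (hj : Primrec j) : Primrec fun a => termEqF (c a) (x a) (i a) (y a) (j a) :=
  primrec_neg (primrec_exSets (primrec_maxPos.comp hc) (primrec_and (primrec_closedF hc)
    (primrec_and (primrec_mem hx (Primrec.nat_add.comp hi (.const 2)))
      (primrec_neg (primrec_mem hy (Primrec.nat_add.comp hj (.const 2)))))))

theorem primrec_bodyMatchF (hc : Primrec c) (hρ : Primrec ρ) (hx : Primrec x) :
    Primrec fun a => bodyMatchF (c a) (ρ a) (x a) := by
  have hf : Primrec fun q : (α × ℕ) × ℕ => q.1.1 := Primrec.fst.comp Primrec.fst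
  have hi : Primrec fun q : (α × ℕ) × ℕ => q.1.2 := Primrec.snd.comp Primrec.fst
  have hv := primrec_bodyVars.comp (hρ.comp hf)
  exact primrec_and (primrec_or (primrec_const (primrec_decide_eq (primrec_body.comp hρ) (.const none)))
      (primrec_shapeF hc hx (primrec_bodyShape.comp hρ)))
    (primrec_conj_positions hc (primrec_imp (primrec_const (primrec_sameVar hv hi hv Primrec.snd))
      (primrec_termEqF (hc.comp hf) (hx.comp hf) hi (hx.comp hf) Primrec.snd)))

theorem primrec_forestF (hc : Primrec c) (hx : Primrec x) :
    Primrec fun a => forestF (c a) (x a) :=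
  primrec_allNode (.const 10) (primrec_allNode (.const 11) (primrec_imp
    (primrec_suffixF (Primrec.fst.comp hc) (.const 11) hx)
    (primrec_conj (primrec_symbols.comp (Primrec.fst.comp hc)) (primrec_imp
      (primrec_child Primrec.snd (.const 10) (.const 11))
      (primrec_bodyMatchF (hc.comp Primrec.fst) (Primrec.fst.comp Primrec.snd) (.const 10))))))

theorem primrec_teamF (hc : Primrec c) (hρ : Primrec ρ) : Primrec fun a => teamF (c a) (ρ a) := by
  have hf : Primrec fun q : (α × ℕ) × ℕ => q.1.1 := Primrec.fst.comp Primrec.fst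
  have hi : Primrec fun q : (α × ℕ) × ℕ => q.1.2 := Primrec.snd.comp Primrec.fst
  have hb : ∀ ι : Fin 2, Primrec fun q : (α × ℕ) × ℕ => (ρ q.1.1, ι) := fun ι =>
    Primrec.pair (hρ.comp hf) (.const ι)
  refine primrec_and (primrec_conj_fin_two fun ι => primrec_and (primrec_forestF hc (.const _))
      (primrec_shapeF hc (.const _) (primrec_headShape.comp (Primrec.pair hρ (.const ι)))))
    (primrec_conj_positions hc (primrec_conj_fin_two fun ι => primrec_and (primrec_imp
      (primrec_const (primrec_isCopy (hb ι) hi Primrec.snd))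
      (primrec_termEqF (hc.comp hf) (.const 0) Primrec.snd (.const _) hi))
      (primrec_conj_fin_two fun κ => primrec_imp (primrec_const (primrec_sameVar
        (primrec_headVars.comp (hb ι)) hi (primrec_headVars.comp (hb κ)) Primrec.snd))
        (primrec_termEqF (hc.comp hf) (.const _) hi (.const _) Primrec.snd))))

theorem primrec_pathF : Primrec pathF :=
  primrec_and (primrec_allNode (.const 10) (primrec_imp (primrec_rootF Primrec.fst (.const 10))
      (.const _)))
    (primrec_and (primrec_allNode (.const 10) (primrec_allNode (.const 11) (primrec_imp
      (primrec_childF Primrec.fst (.const 10) (.const 11)) (.const _))))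
      (primrec_allNode (.const 9) (primrec_imp (.const _) (primrec_and
        (primrec_forestF Primrec.id (.const 9)) (primrec_exNode (.const 10) (primrec_and
          (primrec_and (primrec_childF Primrec.fst (.const 9) (.const 10)) (.const _))
          (primrec_allNode (.const 11) (primrec_imp (primrec_and
            (primrec_childF Primrec.fst (.const 9) (.const 11)) (.const _)) (.const _)))))))))

theorem primrec_nearF (x : ℕ) : Primrec fun R => nearF R x := by
  have ha : Primrec fun q : (RuleSet × Rule × Fin 2) × Rule × Fin 2 => q.1.2 :=
    Primrec.snd.comp Primrec.fst
  exact primrec_or (primrec_rootF Primrec.id (.const x)) (primrec_exNode (.const 10)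
    (primrec_exNode (.const 11) (primrec_disj primrec_symbols (primrec_disj
      (primrec_symbols.comp Primrec.fst) (primrec_and (primrec_const
        (primrec_decide_eq (Primrec.fst.comp ha) (Primrec.fst.comp Primrec.snd)))
        (primrec_and (primrec_child ha (.const 10) (.const 11)) (primrec_and (.const _)
          (primrec_child Primrec.snd (.const 10) (.const x)))))))))

theorem primrec_presentF (x : ℕ) : Primrec fun R => presentF R x :=
  primrec_or (primrec_and (primrec_nearF x) (primrec_neg (primrec_and
      (primrec_suffixF Primrec.id (.const 0) (.const x)) (.const _))))
    (primrec_and (primrec_suffixF Primrec.id (.const 5) (.const 0)) (.const _))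

theorem primrec_pathSentence : Primrec pathSentence := by
  have hR : Primrec fun q : (RuleSet × Atom ℕ) × Rule × Fin 2 => q.1.1 :=
    Primrec.fst.comp Primrec.fst
  exact primrec_close (primrec_exSet (.const 0) (primrec_and primrec_pathF
    (primrec_allNode (.const 3) (primrec_allNode (.const 4) (primrec_exNode (.const 5)
      (primrec_and (.const _) (primrec_allNode (.const 0) (primrec_imp (.const _)
        (primrec_allNode (.const 1) (primrec_allNode (.const 2)
          (primrec_conj (primrec_symbols.comp Primrec.fst) (primrec_imp
            (primrec_exNode (.const 10) (primrec_and (.const _)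
              (primrec_child Primrec.snd (.const 0) (.const 10))))
            (primrec_imp (primrec_teamF Primrec.fst (Primrec.fst.comp Primrec.snd))
              (primrec_neg (primrec_and ((primrec_presentF 1).comp hR)
                ((primrec_presentF 2).comp hR))))))))))))))))

end Formulas

end Computability

end Chase

theorem mainTheorem5 :
    ∃ Ω : Chase.RuleSet × Chase.Atom ℕ → Chase.MSO, Computable Ω ∧
      ∀ (ar : ℕ → ℕ) (R : Chase.RuleSet) (ω : Chase.Atom ℕ), Chase.RespectsArity ar R ω →
        (Ω (R, ω)).IsSentence ∧ (Ω (R, ω)).IsOver R ∧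
          (Chase.TreeModels R (Ω (R, ω)) ↔
            ∃ M P : ℕ → Chase.Trigger R, Chase.IsSensitivePathDerivation R ω M P) := by
  refine ⟨Chase.pathSentence, Chase.primrec_pathSentence.to_comp, fun _ R ω _ =>
    ⟨Chase.MSO.isSentence_close _, Chase.isOver_pathSentence (R, ω),
      Chase.treeModels_pathSentence.trans ⟨?_, ?_⟩⟩⟩
  · rintro ⟨A, hA⟩
    exact hA.exists_isSensitivePathDerivation
  · rintro ⟨M, P, D⟩
    exact D.exists_isUnblockedPath
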